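/- Let $\mathcal{C}$ be an essentially small exact category (in the sense of Quillen). Let $\mathsf{Lex}(\mathcal{C})$ be the abelian category of left exact presheaves on $\mathcal{C}$, i.e. functors $F\colon\mathcal{C}^{op}\to\mathsf{Ab}$ such that $0\to F(Z)\to F(Y)\to F(X)$ is exact for every exact sequence $X\hookrightarrow Y\twoheadrightarrow Z$ in $\mathcal{C}$; its exact sequences are all its short exact sequences (kernel-cokernel pairs). An admissible Ind-diagram is a functor $X\colon I\to\mathcal{C}$ from a (small, non-empty) directed poset $I$ which takes every arrow of $I$ to an admissible monic. For an infinite cardinal $\kappa$, let $\mathsf{Ind}^a_\kappa(\mathcal{C})$ be the full subcategory of $\mathsf{Lex}(\mathcal{C})$ of those presheaves which are isomorphic to $Y\mapsto\operatorname{colim}_I\hom_{\mathcal{C}}(Y,X_i)$ for some admissible Ind-diagram $X$ with $|I|\le\kappa$, and let $\mathsf{Ind}^a(\mathcal{C})$ be defined in the same way without the bound on $|I|$. Let $\mathcal{I}$ be $\mathsf{Ind}^a_\kappa(\mathcal{C})$ for any infinite cardinal $\kappa$, or $\mathsf{Ind}^a(\mathcal{C})$. Then: 1. $\mathcal{I}$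 is closed under extensions in $\mathsf{Lex}(\mathcal{C})$: if $X\hookrightarrow F\twoheadrightarrow Z$ is exact in $\mathsf{Lex}(\mathcal{C})$ with $X,Z\in\mathcal{I}$, then $F\in\mathcal{I}$. 2. $\mathcal{I}$, with the sequences in $\mathcal{I}$ that are exact in $\mathsf{Lex}(\mathcal{C})$ as its exact sequences, is an exact category. 3. If $\mathcal{C}$ is weakly idempotent complete (every map with a right inverse has a kernel), then $\mathcal{I}$ is left special in $\mathsf{Lex}(\mathcal{C})$: for every exact sequence $G\hookrightarrow F\twoheadrightarrow X$ in $\mathsf{Lex}(\mathcal{C})$ with $X\in\mathcal{I}$ there are an exact sequence $Z\hookrightarrow Y\twoheadrightarrow X$ in $\mathcal{I}$ and maps $Z\to G$, $Y\to F$ which, together with $1_X$, form a commutative diagram from $Z\hookrightarrow Y\twoheadrightarrow X$ to $G\hookrightarrow F\twoheadrightarrow X$. -/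

import Mathlib

open CategoryTheory CategoryTheory.Limits

universe v u

namespace ExactCat

section ExactStructures

variable {C : Type u} [Category.{v} C] [Preadditive C]

/-- The sequence `S.X₁ ⟶ S.X₂ ⟶ S.X₃` is a kernel-cokernel pair: `S.f` is a kernel of `S.g` and
`S.g` is a cokernel of `S.f`. -/
def IsKernelCokernelPair (S : ShortComplex C) : Prop :=
  Nonempty (IsLimit (KernelFork.ofι S.f S.zero)) ∧
    Nonempty (IsColimit (CokernelCofork.ofπ S.g S.zero))

/-- Admissible monics for a class `E` of sequences: the first maps of the sequences in `E`. -/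
def AdmissibleMono (E : ObjectProperty (ShortComplex C)) {X Y : C} (i : X ⟶ Y) : Prop :=
  ∃ (Z : C) (p : Y ⟶ Z) (w : i ≫ p = 0), E (ShortComplex.mk i p w)

/-- Admissible epics for a class `E` of sequences: the second maps of the sequences in `E`. -/
def AdmissibleEpi (E : ObjectProperty (ShortComplex C)) {Y Z : C} (p : Y ⟶ Z) : Prop :=
  ∃ (X : C) (i : X ⟶ Y) (w : i ≫ p = 0), E (ShortComplex.mk i p w)

/-- The category `C` is additive and, together with the class `E` of (short) exact sequences,
it is an exact category in the sense of Quillen. -/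
structure IsExactCategory (E : ObjectProperty (ShortComplex C)) : Prop where
  hasFiniteBiproducts : HasFiniteBiproducts C
  isKernelCokernelPair : ∀ S : ShortComplex C, E S → IsKernelCokernelPair S
  of_iso : ∀ S T : ShortComplex C, Nonempty (S ≅ T) → E S → E T
  id_mono : ∀ X : C, AdmissibleMono E (𝟙 X)
  id_epi : ∀ X : C, AdmissibleEpi E (𝟙 X)
  comp_mono : ∀ {X Y Z : C} (i : X ⟶ Y) (j : Y ⟶ Z),
    AdmissibleMono E i → AdmissibleMono E j → AdmissibleMono E (i ≫ j)
  comp_epi : ∀ {X Y Z : C} (p : X ⟶ Y) (q : Y ⟶ Z),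
    AdmissibleEpi E p → AdmissibleEpi E q → AdmissibleEpi E (p ≫ q)
  pushout_mono : ∀ {X Y X' : C} (i : X ⟶ Y) (f : X ⟶ X'), AdmissibleMono E i →
    ∃ (Y' : C) (g : Y ⟶ Y') (i' : X' ⟶ Y'), IsPushout i f g i' ∧ AdmissibleMono E i'
  pullback_epi : ∀ {Y Z Z' : C} (p : Y ⟶ Z) (f : Z' ⟶ Z), AdmissibleEpi E p →
    ∃ (Y' : C) (g : Y' ⟶ Y) (p' : Y' ⟶ Z'), IsPullback g p' p f ∧ AdmissibleEpi E p'

/-- The full subcategory `P` is closed under extensions, with respect to the class `E` of exact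
sequences of the ambient category. -/
def ClosedUnderExtensions (E : ObjectProperty (ShortComplex C)) (P : ObjectProperty C) : Prop :=
  ∀ S : ShortComplex C, E S → P S.X₁ → P S.X₃ → P S.X₂

/-- The class of those sequences in the full subcategory `P` which are exact in the ambient
category. -/
def inheritedClass (E : ObjectProperty (ShortComplex C)) (P : ObjectProperty C) :
    ObjectProperty (ShortComplex P.FullSubcategory) :=
  fun S => E (ShortComplex.mk S.f.hom S.g.hom (congrArg InducedCategory.Hom.hom S.zero))

/-- The full subcategory `P`, with class of exact sequences `EP`, is left special in the ambient
category, with class of exact sequences `E`: for each exact sequence `G ⟶ F ⟶ X` in the ambient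
category with `X` in `P` there are an exact sequence `Z ⟶ Y ⟶ X` in `P` and vertical maps
`a : Z ⟶ G` and `b : Y ⟶ F` which, with the identity of `X`, form a morphism of sequences. -/
def LeftSpecial (E : ObjectProperty (ShortComplex C)) (P : ObjectProperty C)
    (EP : ObjectProperty (ShortComplex P.FullSubcategory)) : Prop :=
  ∀ (X : P.FullSubcategory) (G F : C) (j : G ⟶ F) (q : F ⟶ X.obj) (w : j ≫ q = 0),
    E (ShortComplex.mk j q w) →
      ∃ (Z Y : P.FullSubcategory) (i : Z ⟶ Y) (p : Y ⟶ X) (w' : i ≫ p = 0)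
        (a : Z.obj ⟶ G) (b : Y.obj ⟶ F),
        EP (ShortComplex.mk i p w') ∧ i.hom ≫ b = a ≫ j ∧ b ≫ q = p.hom

variable (C) in
/-- Every retraction has a kernel. -/
def WeaklyIdempotentComplete : Prop :=
  ∀ (X Y : C) (r : X ⟶ Y) (s : Y ⟶ X), s ≫ r = 𝟙 Y → HasKernel r

end ExactStructures

section IndObjects

variable {C : Type u} [Category.{v} C] [Preadditive C]

/-- A presheaf `F` of abelian groups is left exact if `0 → F(Z) → F(Y) → F(X)` is exact for each
exact sequence `X ⟶ Y ⟶ Z`. -/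
def IsLeftExact (E : ObjectProperty (ShortComplex C)) :
    ObjectProperty (Cᵒᵖ ⥤ AddCommGrpCat.{v}) :=
  fun F => ∀ S : ShortComplex C, E S →
    Function.Injective (F.map S.g.op) ∧ Function.Exact (F.map S.g.op) (F.map S.f.op)

/-- The category of left exact presheaves of abelian groups. -/
abbrev Lex (E : ObjectProperty (ShortComplex C)) := (IsLeftExact E).FullSubcategory

/-- The exact sequences of the abelian category `Lex E`: all kernel-cokernel pairs in it. -/
def lexExact (E : ObjectProperty (ShortComplex C)) : ObjectProperty (ShortComplex (Lex E)) :=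
  IsKernelCokernelPair

/-- An admissible Ind-diagram: a functor to `C` from a directed poset, which takes each arrow to an
admissible monic. -/
structure AdmissibleIndDiagram (E : ObjectProperty (ShortComplex C)) where
  I : Type v
  [order : PartialOrder I]
  [directed : IsDirectedOrder I]
  [nonempty : Nonempty I]
  X : I ⥤ C
  admissible : ∀ {i j : I} (f : i ⟶ j), AdmissibleMono E (X.map f)

attribute [instance] AdmissibleIndDiagram.order

/-- The presheaf `Y ↦ colim_I Hom(Y, X_i)` of abelian groups. -/
noncomputable def AdmissibleIndDiagram.presheaf {E : ObjectProperty (ShortComplex C)}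
    (D : AdmissibleIndDiagram E) : Cᵒᵖ ⥤ AddCommGrpCat.{v} :=
  colimit (D.X ⋙ preadditiveYoneda)

/-- Admissible Ind-objects: left exact presheaves isomorphic to the presheaf of an admissible
Ind-diagram. -/
def IndA (E : ObjectProperty (ShortComplex C)) : ObjectProperty (Lex E) :=
  fun F => ∃ D : AdmissibleIndDiagram E, Nonempty (F.obj ≅ D.presheaf)

/-- Admissible Ind-objects of size at most `κ`: the index poset has cardinality at most `κ`. -/
def IndAOfSize (E : ObjectProperty (ShortComplex C)) (κ : Cardinal.{v}) :
    ObjectProperty (Lex E) :=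
  fun F => ∃ D : AdmissibleIndDiagram E, Cardinal.mk D.I ≤ κ ∧ Nonempty (F.obj ≅ D.presheaf)

end IndObjects

end ExactCat

namespace ExactCat

/-! ### Exact categories: pushouts, the short five lemma, the obscure axiom, weak idempotent
completeness -/

section Basics

open scoped ZeroObject

variable {C : Type u} [Category.{v} C] [Preadditive C] {E : ObjectProperty (ShortComplex C)}

/-! Single admissible epics are the coverings of a Grothendieck topology on `C`, and the left exact
presheaves are exactly the additive sheaves for it. A kernel-cokernel pair in `Lex E` is then a
sequence that is exact on sections, except that sections of the quotient lift only after restriction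
along an admissible epic (`lexExact_iff_isLocallyExact`). An admissible Ind-object is a directed
union of representable subpresheaves, given by sections over the `X i` (`IndPresentation`), so
everything becomes a computation with sections.

Extensions (`exists_diagram_of_isLocallyExact`): let `X` be the union of the `A i` and `Z` that of
the `B j`. The section of `Z` over `B j` lifts to `F` over some `P ⟶ B j`. On the kernel `K` of this
epic the lift lies in `X`, hence in `A i` for large `i`. The pushout of `K ⟶ P` along `K ⟶ A i` is
an extension of `B j` by `A i` inside `F`. These pieces are directed and exhaust `F`; their
transition maps are admissible monics because the outer components are (`admissibleMono_of_exact`).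
They are indexed by a subset of `I × J`.

Exact structure: the embedding of `Lex E` into the abelian category of sheaves is exact in both
directions (`lexExact_iff`). A sheaf extension of left exact presheaves is left exact
(`isLeftExact_of_shortExact`), so the Ind-objects are extension-closed among sheaves, and such
subcategories are exact (`isExactCategory_shortExactClass`).

Left specialness (`exists_resolution`): lift the section over each `X i` to `F` over some admissible
epic `P i ⟶ X i`. For a finite set `s` of indices with greatest element `t`, the sum of the `P j`,
`j ∈ s`, maps to `X t`. Weak idempotent completeness makes this map an admissible epic, since its
component at `t` is one. The sums and their kernels form the Ind-objects `Y` and `Z`. -/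

lemma isPushout_of_exists {W X Y Z : C} {f : W ⟶ X} {g : W ⟶ Y} {h : X ⟶ Z} {i : Y ⟶ Z}
    (w : f ≫ h = g ≫ i)
    (hd : ∀ {T : C} (a : X ⟶ T) (b : Y ⟶ T), f ≫ a = g ≫ b → ∃ l, h ≫ l = a ∧ i ≫ l = b)
    (hu : ∀ {T : C} (l : Z ⟶ T), h ≫ l = 0 → i ≫ l = 0 → l = 0) : IsPushout f g h i := by
  choose! d hd₁ hd₂ using @hd
  refine ⟨⟨w⟩, ⟨PushoutCocone.IsColimit.mk _ (fun c => d c.inl c.inr)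
    (fun c => hd₁ _ _ c.condition) (fun c => hd₂ _ _ c.condition) ?_⟩⟩
  intro c m h₁ h₂
  refine sub_eq_zero.1 (hu _ ?_ ?_)
  · rw [Preadditive.comp_sub, h₁, hd₁ _ _ c.condition, sub_self]
  · rw [Preadditive.comp_sub, h₂, hd₂ _ _ c.condition, sub_self]

lemma isPullback_of_exists {W X Y Z : C} {f : W ⟶ X} {g : W ⟶ Y} {h : X ⟶ Z} {i : Y ⟶ Z}
    (w : f ≫ h = g ≫ i)
    (hd : ∀ {T : C} (a : T ⟶ X) (b : T ⟶ Y), a ≫ h = b ≫ i → ∃ l, l ≫ f = a ∧ l ≫ g = b)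
    (hu : ∀ {T : C} (l : T ⟶ W), l ≫ f = 0 → l ≫ g = 0 → l = 0) : IsPullback f g h i := by
  choose! d hd₁ hd₂ using @hd
  refine ⟨⟨w⟩, ⟨PullbackCone.IsLimit.mk _ (fun c => d c.fst c.snd)
    (fun c => hd₁ _ _ c.condition) (fun c => hd₂ _ _ c.condition) ?_⟩⟩
  intro c m h₁ h₂
  refine sub_eq_zero.1 (hu _ ?_ ?_)
  · rw [Preadditive.sub_comp, h₁, hd₁ _ _ c.condition, sub_self]
  · rw [Preadditive.sub_comp, h₂, hd₂ _ _ c.condition, sub_self]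

/-- The automorphism `(x, y) ↦ (x, y + f x)`. -/
@[simps]
noncomputable def shearRight {X Y : C} [HasBinaryBiproduct X Y] (f : X ⟶ Y) : X ⊞ Y ≅ X ⊞ Y where
  hom := biprod.lift biprod.fst (biprod.snd + biprod.fst ≫ f)
  inv := biprod.lift biprod.fst (biprod.snd - biprod.fst ≫ f)

/-- The automorphism `(x, y) ↦ (x + f y, y)`. -/
@[simps]
noncomputable def shearLeft {X Y : C} [HasBinaryBiproduct X Y] (f : Y ⟶ X) : X ⊞ Y ≅ X ⊞ Y where
  hom := biprod.lift (biprod.fst + biprod.snd ≫ f) biprod.snd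
  inv := biprod.lift (biprod.fst - biprod.snd ≫ f) biprod.snd

namespace IsKernelCokernelPair

variable {S : ShortComplex C} (h : IsKernelCokernelPair S)
include h

lemma mono_f : Mono S.f := mono_of_isLimit_fork h.1.some

lemma epi_g : Epi S.g := epi_of_isColimit_cofork h.2.some

lemma exists_lift {T : C} (k : T ⟶ S.X₂) (hk : k ≫ S.g = 0) : ∃ l, l ≫ S.f = k :=
  ⟨h.1.some.lift (KernelFork.ofι k hk), h.1.some.fac _ WalkingParallelPair.zero⟩

lemma exists_desc {T : C} (k : S.X₂ ⟶ T) (hk : S.f ≫ k = 0) : ∃ l, S.g ≫ l = k :=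
  ⟨h.2.some.desc (CokernelCofork.ofπ k hk), h.2.some.fac _ WalkingParallelPair.one⟩

end IsKernelCokernelPair

namespace IsExactCategory

variable (hE : IsExactCategory E)
include hE

lemma mono_of_exact {X Y Z : C} {i : X ⟶ Y} {p : Y ⟶ Z} {w : i ≫ p = 0}
    (h : E (ShortComplex.mk i p w)) : Mono i := (hE.isKernelCokernelPair _ h).mono_f

lemma epi_of_exact {X Y Z : C} {i : X ⟶ Y} {p : Y ⟶ Z} {w : i ≫ p = 0}
    (h : E (ShortComplex.mk i p w)) : Epi p := (hE.isKernelCokernelPair _ h).epi_g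

lemma exists_lift {X Y Z : C} {i : X ⟶ Y} {p : Y ⟶ Z} {w : i ≫ p = 0}
    (h : E (ShortComplex.mk i p w)) {T : C} (k : T ⟶ Y) (hk : k ≫ p = 0) : ∃ l, l ≫ i = k :=
  (hE.isKernelCokernelPair _ h).exists_lift k hk

lemma exists_desc {X Y Z : C} {i : X ⟶ Y} {p : Y ⟶ Z} {w : i ≫ p = 0}
    (h : E (ShortComplex.mk i p w)) {T : C} (k : Y ⟶ T) (hk : i ≫ k = 0) : ∃ l, p ≫ l = k :=
  (hE.isKernelCokernelPair _ h).exists_desc k hk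

lemma mono_of_admissibleMono {X Y : C} {i : X ⟶ Y} (h : AdmissibleMono E i) : Mono i := by
  obtain ⟨_, _, _, h⟩ := h
  exact hE.mono_of_exact h

lemma epi_of_admissibleEpi {X Y : C} {i : X ⟶ Y} (h : AdmissibleEpi E i) : Epi i := by
  obtain ⟨_, _, _, h⟩ := h
  exact hE.epi_of_exact h

lemma exact_of_isos {X Y Z X' Y' Z' : C} {i : X ⟶ Y} {p : Y ⟶ Z} {w : i ≫ p = 0}
    (h : E (ShortComplex.mk i p w)) {i' : X' ⟶ Y'} {p' : Y' ⟶ Z'} (w' : i' ≫ p' = 0)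
    (e₁ : X ≅ X') (e₂ : Y ≅ Y') (e₃ : Z ≅ Z') (h₁ : e₁.hom ≫ i' = i ≫ e₂.hom)
    (h₂ : e₂.hom ≫ p' = p ≫ e₃.hom) : E (ShortComplex.mk i' p' w') :=
  hE.of_iso (ShortComplex.mk i p w) (ShortComplex.mk i' p' w')
    ⟨ShortComplex.isoMk e₁ e₂ e₃ h₁ h₂⟩ h

/-- A kernel of an admissible epic forms an exact sequence with it. -/
lemma exact_of_kernel {X Y Z : C} {i : X ⟶ Y} {p : Y ⟶ Z} (w : i ≫ p = 0)
    (hp : AdmissibleEpi E p) (hi : Mono i)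
    (hl : ∀ {T : C} (k : T ⟶ Y), k ≫ p = 0 → ∃ l, l ≫ i = k) : E (ShortComplex.mk i p w) := by
  obtain ⟨X', i', w', h⟩ := hp
  have := hE.mono_of_exact h
  obtain ⟨a, ha⟩ := hl i' w'
  obtain ⟨b, hb⟩ := hE.exists_lift h i w
  refine hE.exact_of_isos h w (Iso.mk a b ?_ ?_) (Iso.refl _) (Iso.refl _) ?_ ?_
  · simp [← cancel_mono i', ha, hb]
  · simp [← cancel_mono i, ha, hb]
  · simp [ha]
  · simp

/-- A cokernel of an admissible monic forms an exact sequence with it. -/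
lemma exact_of_cokernel {X Y Z : C} {i : X ⟶ Y} {p : Y ⟶ Z} (w : i ≫ p = 0)
    (hi : AdmissibleMono E i) (hp : Epi p)
    (hl : ∀ {T : C} (k : Y ⟶ T), i ≫ k = 0 → ∃ l, p ≫ l = k) : E (ShortComplex.mk i p w) := by
  obtain ⟨Z', p', w', h⟩ := hi
  have := hE.epi_of_exact h
  obtain ⟨a, ha⟩ := hl p' w'
  obtain ⟨b, hb⟩ := hE.exists_desc h p w
  refine hE.exact_of_isos h w (Iso.refl _) (Iso.refl _) (Iso.mk b a ?_ ?_) ?_ ?_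
  · simp [← cancel_epi p', reassoc_of% hb, ha]
  · simp [← cancel_epi p, reassoc_of% ha, hb]
  · simp
  · simp [hb]

/-- Every pushout of an admissible monic yields an exact sequence with the same cokernel. -/
lemma exact_of_isPushout {X Y Z X' Y' : C} {i : X ⟶ Y} {p : Y ⟶ Z} {w : i ≫ p = 0}
    (h : E (ShortComplex.mk i p w)) {f : X ⟶ X'} {g : Y ⟶ Y'} {i' : X' ⟶ Y'} {p' : Y' ⟶ Z}
    (hP : IsPushout i f g i') (hg : g ≫ p' = p) (w' : i' ≫ p' = 0) :
    E (ShortComplex.mk i' p' w') := by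
  obtain ⟨Y₀, g₀, i₀, hP₀, Z₀, p₀, w₀, h₀⟩ := hE.pushout_mono i f ⟨Z, p, w, h⟩
  have := hE.epi_of_exact h
  refine hE.exact_of_cokernel _ ?_ (epi_of_epi_fac hg) ?_
  · exact ⟨Z₀, (hP₀.isoIsPushout _ _ hP).inv ≫ p₀, by simp [w₀], hE.exact_of_isos h₀ _
      (Iso.refl _) (hP₀.isoIsPushout _ _ hP) (Iso.refl _) (by simp) (by simp)⟩
  · intro T k hk
    obtain ⟨l, hl⟩ := hE.exists_desc h (g ≫ k) (by rw [hP.w_assoc, hk, comp_zero])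
    refine ⟨l, hP.hom_ext ?_ ?_⟩
    · rw [reassoc_of% hg, hl]
    · rw [reassoc_of% w', hk, zero_comp]

lemma exact_of_isPullback {X Y Z Z' Y' : C} {i : X ⟶ Y} {p : Y ⟶ Z} {w : i ≫ p = 0}
    (h : E (ShortComplex.mk i p w)) {f : Z' ⟶ Z} {g : Y' ⟶ Y} {p' : Y' ⟶ Z'} {i' : X ⟶ Y'}
    (hP : IsPullback g p' p f) (hg : i' ≫ g = i) (w' : i' ≫ p' = 0) :
    E (ShortComplex.mk i' p' w') := by
  obtain ⟨Y₀, g₀, p₀, hP₀, X₀, i₀, w₀, h₀⟩ := hE.pullback_epi p f ⟨X, i, w, h⟩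
  have := hE.mono_of_exact h
  refine hE.exact_of_kernel _ ?_ (mono_of_mono_fac hg) ?_
  · exact ⟨X₀, i₀ ≫ (hP₀.isoIsPullback _ _ hP).hom, by simp [w₀], hE.exact_of_isos h₀ _
      (Iso.refl _) (hP₀.isoIsPullback _ _ hP) (Iso.refl _) (by simp) (by simp)⟩
  · intro T k hk
    obtain ⟨l, hl⟩ := hE.exists_lift h (k ≫ g)
      (by rw [Category.assoc, hP.w, reassoc_of% hk, zero_comp])
    refine ⟨l, hP.hom_ext ?_ ?_⟩
    · rw [Category.assoc, hg, hl]
    · rw [Category.assoc, w', hk, comp_zero]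

lemma admissibleMono_iso {X Y : C} (e : X ≅ Y) : AdmissibleMono E e.hom := by
  obtain ⟨Z, p, w, h⟩ := hE.id_mono X
  exact ⟨Z, e.inv ≫ p, by simpa using w, hE.exact_of_isos h _ (Iso.refl _) e (Iso.refl _)
    (by simp) (by simp)⟩

lemma admissibleEpi_iso {X Y : C} (e : X ≅ Y) : AdmissibleEpi E e.hom := by
  obtain ⟨Z, p, w, h⟩ := hE.id_epi Y
  exact ⟨Z, p ≫ e.inv, by simpa using w, hE.exact_of_isos h _ (Iso.refl _) e.symm (Iso.refl _)
    (by simp) (by simp)⟩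

/-- The sequence `Y ⟶ Y ⊞ Z ⟶ Z` is exact. -/
lemma exact_of_isBilimit {Y Z : C} {b : BinaryBicone Y Z} (hb : b.IsBilimit) :
    E (ShortComplex.mk b.inl b.snd b.inl_snd) := by
  have := hE.hasFiniteBiproducts
  have : HasZeroObject C := hasZeroObject_of_hasFiniteBiproducts C
  obtain ⟨A, i, w, h⟩ := hE.id_epi Z
  obtain rfl : i = 0 := by simpa using w
  have h0 : E (ShortComplex.mk (0 : (0 : C) ⟶ Z) (𝟙 Z) (by simp)) := by
    refine hE.exact_of_kernel _ ⟨_, _, _, h⟩ inferInstance ?_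
    intro T k hk
    exact ⟨0, by simpa using hk.symm⟩
  -- `Y ⊞ Z` is the pushout of `0 ⟶ Z` along `0 ⟶ Y`.
  exact hE.exact_of_isPushout h0 (IsPushout.of_isBilimit hb).flip (by simp) _

lemma exact_inl_snd (Y Z : C) [HasBinaryBiproduct Y Z] :
    E (ShortComplex.mk (biprod.inl : Y ⟶ Y ⊞ Z) biprod.snd biprod.inl_snd) :=
  hE.exact_of_isBilimit (BinaryBiproduct.isBilimit Y Z)

lemma hasBinaryBiproducts : HasBinaryBiproducts C :=
  have := hE.hasFiniteBiproducts
  hasBinaryBiproducts_of_finite_biproducts C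

/-- The exact sequence `X ⟶ Y ⊞ X' ⟶ Y'` of a pushout of an admissible monic. -/
lemma exact_biprod_of_isPushout [HasBinaryBiproducts C] {X Y X' Y' : C} {i : X ⟶ Y}
    (hi : AdmissibleMono E i) {f : X ⟶ X'} {g : Y ⟶ Y'} {i' : X' ⟶ Y'}
    (hP : IsPushout i f g i') :
    E (ShortComplex.mk (biprod.lift i (-f)) (biprod.desc g i') (by simp [hP.w])) := by
  obtain ⟨Z, p, w, h⟩ := hi
  have hQ : IsPushout i biprod.inl biprod.inl (biprod.map i (𝟙 X')) := by
    refine isPushout_of_exists (by simp) (fun a b hab => ?_) (fun l h₁ h₂ => ?_)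
    · exact ⟨biprod.desc a (biprod.inr ≫ b), by simp, by ext <;> simp [hab]⟩
    · ext
      · simpa using h₁
      · simpa using biprod.inr ≫= h₂
  have h₁ : AdmissibleMono E (biprod.map i (𝟙 X')) :=
    ⟨_, biprod.fst ≫ p, by ext <;> simp [w], hE.exact_of_isPushout h hQ (by simp) _⟩
  have h₂ : AdmissibleMono E (biprod.lift i (-f)) := by
    have := hE.comp_mono _ _ (hE.comp_mono _ _ ⟨_, _, _, hE.exact_inl_snd X X'⟩
      (hE.admissibleMono_iso (shearRight (-f)))) h₁
    convert this using 1
    ext <;> simp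
  refine hE.exact_of_cokernel _ h₂ ⟨fun a b hab => hP.hom_ext ?_ ?_⟩ (fun k hk => ?_)
  · simpa using biprod.inl ≫= hab
  · simpa using biprod.inr ≫= hab
  · have : i ≫ biprod.inl ≫ k = f ≫ biprod.inr ≫ k := by
      rw [← sub_eq_zero, ← hk, biprod.lift_eq]
      simp [sub_eq_add_neg]
    exact ⟨hP.desc _ _ this, by ext <;> simp⟩

/-- The obscure axiom: `p` is an admissible epic if it has a kernel and some `b ≫ p` is an
admissible epic. -/
lemma exact_of_kernel_of_comp {A B D Z : C} {i : A ⟶ B} {p : B ⟶ Z} (w : i ≫ p = 0)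
    (hi : Mono i) (hl : ∀ {T : C} (k : T ⟶ B), k ≫ p = 0 → ∃ l, l ≫ i = k)
    (b : D ⟶ B) (hb : AdmissibleEpi E (b ≫ p)) : E (ShortComplex.mk i p w) := by
  have := hE.hasBinaryBiproducts
  have h₁ : AdmissibleEpi E (biprod.map (𝟙 B) (b ≫ p)) := by
    obtain ⟨K, k, wk, hk⟩ := hb
    have hQ : IsPullback biprod.snd (biprod.map (𝟙 B) (b ≫ p)) (b ≫ p) biprod.snd := by
      refine isPullback_of_exists (by simp) (fun a c hac => ?_) (fun l h₁ h₂ => ?_)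
      · exact ⟨biprod.lift (c ≫ biprod.fst) a, by simp, by ext <;> simp [hac]⟩
      · ext
        · simpa using h₂ =≫ biprod.fst
        · simpa using h₁
    exact ⟨K, k ≫ biprod.inr, by ext <;> simp [wk],
      hE.exact_of_isPullback hk hQ (by simp) _⟩
  -- Up to two shears this is `b ≫ p` on the second summand: `(x, y) ↦ (x - b y, y) ↦ (x - b y, p b
  -- y)`, and adding `p` of the first entry to the second leaves `p x`.
  have h₂ : AdmissibleEpi E (biprod.fst ≫ p : B ⊞ D ⟶ Z) := by
    have := hE.comp_epi _ _ (hE.comp_epi _ _ (hE.comp_epi _ _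
      (hE.admissibleEpi_iso (shearLeft (-b))) h₁)
      (hE.admissibleEpi_iso (shearRight p))) ⟨_, _, _, hE.exact_inl_snd B Z⟩
    convert this using 1
    ext <;> simp
  have h₃ : E (ShortComplex.mk (biprod.map i (𝟙 D)) (biprod.fst ≫ p)
      (by ext <;> simp [w])) := by
    refine hE.exact_of_kernel _ h₂ inferInstance (fun k hk => ?_)
    obtain ⟨l, hl⟩ := hl (k ≫ biprod.fst) (by simpa using hk)
    exact ⟨biprod.lift l (k ≫ biprod.snd), by ext <;> simp [hl]⟩
  refine hE.exact_of_isPushout h₃ (f := biprod.fst) (g := biprod.fst) ?_ rfl w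
  refine isPushout_of_exists (by simp) (fun a c hac => ?_) (fun l h₁ h₂ => ?_)
  · refine ⟨biprod.inl ≫ a, ?_, ?_⟩
    · ext
      · simp
      · simpa using (biprod.inr ≫= hac).symm
    · simpa using biprod.inl ≫= hac
  · simpa using biprod.inl ≫= h₁

/-- The short five lemma by a diagram chase. Over the pullback `Q`, the naive lift `u` of `q` is off
by a map into `X`; the corrected lift descends along `q` because `φ` is monic. -/
lemma isIso_of_exact {X Z M N : C} {s : X ⟶ M} {p : M ⟶ Z} {w : s ≫ p = 0} {s' : X ⟶ N}
    {p' : N ⟶ Z} {w' : s' ≫ p' = 0} (h : E (ShortComplex.mk s p w))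
    (h' : E (ShortComplex.mk s' p' w')) (φ : M ⟶ N) (h₁ : s ≫ φ = s') (h₂ : φ ≫ p' = p) :
    IsIso φ := by
  have := hE.mono_of_exact h'
  have hφ : ∀ {T : C} (y : T ⟶ M), y ≫ φ = 0 → y = 0 := by
    intro T y hy
    obtain ⟨l, rfl⟩ := hE.exists_lift h y (by rw [← h₂, reassoc_of% hy, zero_comp])
    rw [Category.assoc, h₁, ← zero_comp (Y := X), cancel_mono] at hy
    rw [hy, zero_comp]
  obtain ⟨Q, u, q, hP, hq⟩ := hE.pullback_epi p p' ⟨_, _, _, h⟩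
  have := hE.epi_of_admissibleEpi hq
  obtain ⟨l, hl⟩ := hE.exists_lift h' (q - u ≫ φ) (by simp [h₂, hP.w])
  obtain ⟨K, m, wm, hm⟩ := hq
  have hq' : (u + l ≫ s) ≫ φ = q := by simp [h₁, hl]
  obtain ⟨v, hv⟩ := hE.exists_desc hm (u + l ≫ s) (hφ _ (by rw [Category.assoc, hq', wm]))
  have hvφ : v ≫ φ = 𝟙 N := by rw [← cancel_epi q, reassoc_of% hv, hq', Category.comp_id]
  refine ⟨v, sub_eq_zero.1 (hφ _ ?_), hvφ⟩
  simp [hvφ]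

/-- A morphism of exact sequences is an admissible monic if its outer components are. -/
lemma admissibleMono_of_exact {X Z M X' Z' M' : C} {s : X ⟶ M} {p : M ⟶ Z} {w : s ≫ p = 0}
    {s' : X' ⟶ M'} {p' : M' ⟶ Z'} {w' : s' ≫ p' = 0} (h : E (ShortComplex.mk s p w))
    (h' : E (ShortComplex.mk s' p' w')) {a : X ⟶ X'} {b : M ⟶ M'} {c : Z ⟶ Z'}
    (ha : AdmissibleMono E a) (hc : AdmissibleMono E c) (h₁ : s ≫ b = a ≫ s')
    (h₂ : b ≫ p' = p ≫ c) : AdmissibleMono E b := by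
  -- `b` factors as a pushout of `a`, an isomorphism between two extensions of `Z` by `X'`, and a
  -- pullback of `c`.
  obtain ⟨M₁, s₁, j, hP, hj⟩ := hE.pushout_mono a s ha
  have w₁ : a ≫ 0 = s ≫ p := by simp [w]
  have e₁ := hE.exact_of_isPushout h hP.flip (p' := hP.desc 0 p w₁) (by simp) (by simp)
  obtain ⟨M₂, g, q, hQ, -⟩ := hE.pullback_epi p' c ⟨_, _, _, h'⟩
  have w₂ : s' ≫ p' = 0 ≫ c := by simp [w']
  have e₂ := hE.exact_of_isPullback h' hQ (i' := hQ.lift s' 0 w₂) (by simp) (by simp)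
  have hφ := hE.isIso_of_exact e₁ e₂ (hQ.lift (hP.desc s' b h₁.symm) (hP.desc 0 p w₁)
    (hP.hom_ext (by simp [w']) (by simp [h₂]))) (hQ.hom_ext (by simp) (by simp)) (by simp)
  -- `g` is the kernel of `p'` followed by the cokernel of `c`, a composite of admissible epics.
  have hg : AdmissibleMono E g := by
    obtain ⟨W, d, wd, hd⟩ := hc
    have := hE.mono_of_exact hd
    refine ⟨W, p' ≫ d, by rw [hQ.w_assoc, wd, comp_zero], hE.exact_of_kernel _
      (hE.comp_epi _ _ ⟨_, _, _, h'⟩ ⟨_, _, _, hd⟩) ?_ (fun k hk => ?_)⟩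
    · exact (MorphismProperty.monomorphisms C).of_isPullback hQ.flip this
    · obtain ⟨l, hl⟩ := hE.exists_lift hd (k ≫ p') (by simpa using hk)
      exact ⟨hQ.lift k l hl.symm, by simp⟩
  have := hE.comp_mono _ _ hj (hE.comp_mono _ _ (hE.admissibleMono_iso (@asIso _ _ _ _ _ hφ)) hg)
  convert this using 1
  simp

/-- The pullback of `p` along `b ≫ p` projects to `D` with a section given by `b`. The kernel of
this retraction is also a kernel of `p`, so the obscure axiom applies. -/
lemma admissibleEpi_of_comp (hC : WeaklyIdempotentComplete C) {B D Z : C} (b : D ⟶ B) (p : B ⟶ Z)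
    (hb : AdmissibleEpi E (b ≫ p)) : AdmissibleEpi E p := by
  obtain ⟨D', g, p', hP, -⟩ := hE.pullback_epi _ p hb
  have := hC _ _ g (hP.lift (𝟙 D) b (by simp)) (by simp)
  refine ⟨_, kernel.ι g ≫ p', by rw [Category.assoc, ← hP.w, kernel.condition_assoc, zero_comp],
    hE.exact_of_kernel_of_comp _ ?_ (fun k hk => ?_) b hb⟩
  · refine Preadditive.mono_of_cancel_zero _ (fun k hk => ?_)
    rw [← cancel_mono (kernel.ι g)]
    exact hP.hom_ext (by simp) (by simpa using hk)
  · exact ⟨kernel.lift g (hP.lift 0 k (by simp [hk])) (by simp), by simp⟩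

/-- The pushout `D'` of `i` along `i ≫ j` retracts onto `D`, so it splits as `D` plus the kernel of
the retraction. The map from `B` to that kernel is the cokernel of `i`. The obscure axiom proves
this, so only kernels of retractions are needed. -/
lemma admissibleMono_of_comp (hC : WeaklyIdempotentComplete C) {A B D : C} (i : A ⟶ B) (j : B ⟶ D)
    (hi : AdmissibleMono E (i ≫ j)) : AdmissibleMono E i := by
  have := hE.hasBinaryBiproducts
  obtain ⟨D', g, i', hP, -⟩ := hE.pushout_mono _ i hi
  let r : D' ⟶ D := hP.desc (𝟙 D) j (by simp)
  have hgr : g ≫ r = 𝟙 D := by simp [r]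
  have hir : i' ≫ r = j := by simp [r]
  have := hC _ _ r g hgr
  let π : D' ⟶ kernel r := kernel.lift r (𝟙 D' - r ≫ g) (by simp [hgr])
  have hπ : π ≫ kernel.ι r = 𝟙 D' - r ≫ g := by simp [π]
  have hιπ : kernel.ι r ≫ π = 𝟙 _ := by simp [← cancel_mono (kernel.ι r), hπ]
  have hgπ : g ≫ π = 0 := by simp [← cancel_mono (kernel.ι r), hπ, reassoc_of% hgr]
  have hπe : AdmissibleEpi E π :=
    hE.admissibleEpi_of_comp hC (kernel.ι r) π (by rw [hιπ]; exact hE.id_epi _)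
  have hS := hE.exact_biprod_of_isPushout hi hP
  have : Mono (i ≫ j) := hE.mono_of_admissibleMono hi
  refine ⟨_, i' ≫ π, by rw [← hP.w_assoc, hgπ, comp_zero],
    hE.exact_of_kernel_of_comp _ (mono_of_mono i j) (fun y hy => ?_)
      (biprod.snd : D ⊞ B ⟶ B) ?_⟩
  · have hy' : y ≫ i' = y ≫ j ≫ g := by
      have := hy =≫ kernel.ι r
      simp only [Category.assoc, hπ, zero_comp, Preadditive.comp_sub, Category.comp_id,
        reassoc_of% hir] at this
      exact sub_eq_zero.1 this
    obtain ⟨l, hl⟩ := hE.exists_lift hS (biprod.lift (y ≫ j) (-y)) (by simp [hy'])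
    exact ⟨l, by simpa using hl =≫ biprod.snd⟩
  · have := hE.comp_epi _ _ ⟨_, _, _, hS⟩ hπe
    convert this using 1
    ext <;> simp [hgπ]

end IsExactCategory

end Basics
end ExactCat

namespace ExactCat

/-! ### Presheaves through their sections; Ind-objects as unions of representables -/

section Presheaves

open Opposite

variable {C : Type u} [Category.{v} C]

/-- The restriction of sections of a presheaf along a morphism. -/
def res (F : Cᵒᵖ ⥤ AddCommGrpCat.{v}) {X Y : C} (f : X ⟶ Y) :
    F.obj (op Y) →+ F.obj (op X) := (F.map f.op).hom

section

variable (F G : Cᵒᵖ ⥤ AddCommGrpCat.{v})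

lemma map_op_apply {X Y : C} (f : X ⟶ Y) (x : F.obj (op Y)) : F.map f.op x = res F f x := rfl

@[simp]
lemma res_id {X : C} (x : F.obj (op X)) : res F (𝟙 X) x = x := by simp [res]

lemma res_comp {X Y Z : C} (f : X ⟶ Y) (g : Y ⟶ Z) (x : F.obj (op Z)) :
    res F (f ≫ g) x = res F f (res F g x) := by simp [res]

variable {F G} in
lemma app_res (φ : F ⟶ G) {X Y : C} (f : X ⟶ Y) (x : F.obj (op Y)) :
    φ.app (op X) (res F f x) = res G f (φ.app (op Y) x) :=
  ConcreteCategory.congr_hom (φ.naturality f.op) x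

variable [Preadditive C]

lemma res_add [F.Additive] {X Y : C} (f g : X ⟶ Y) (x : F.obj (op Y)) :
    res F (f + g) x = res F f x + res F g x := by
  simp [res, op_add, F.map_add]

@[simp]
lemma res_zero [F.Additive] {X Y : C} (x : F.obj (op Y)) : res F (0 : X ⟶ Y) x = 0 := by
  have := res_add F (0 : X ⟶ Y) 0 x
  simpa using this

lemma res_neg [F.Additive] {X Y : C} (f : X ⟶ Y) (x : F.obj (op Y)) :
    res F (-f) x = - res F f x := by
  rw [eq_neg_iff_add_eq_zero, ← res_add, neg_add_cancel, res_zero]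

lemma res_sub [F.Additive] {X Y : C} (f g : X ⟶ Y) (x : F.obj (op Y)) :
    res F (f - g) x = res F f x - res F g x := by
  rw [sub_eq_add_neg, sub_eq_add_neg, res_add, res_neg]

lemma res_sum [F.Additive] {X Y : C} {ι : Type*} (s : Finset ι) (f : ι → (X ⟶ Y))
    (x : F.obj (op Y)) : res F (∑ j ∈ s, f j) x = ∑ j ∈ s, res F (f j) x := by
  classical
  induction s using Finset.induction_on with
  | empty => simp
  | insert a s ha ih => rw [Finset.sum_insert ha, Finset.sum_insert ha, res_add, ih]

/-- A presheaf of abelian groups is additive if it kills zero morphisms and sections over `Y ⊞ Y`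
are determined by their restrictions to the summands. -/
lemma additive_of_res [HasBinaryBiproducts C]
    (h₀ : ∀ {X Y : C} (x : F.obj (op Y)), res F (0 : X ⟶ Y) x = 0)
    (h : ∀ {Y : C} (x : F.obj (op (Y ⊞ Y))), res F biprod.inl x = 0 → res F biprod.inr x = 0 →
      x = 0) : F.Additive where
  map_add {Y X f g} := by
    ext x
    have hx := h (res F (biprod.fst + biprod.snd) x - res F biprod.fst x - res F biprod.snd x)
      (by rw [map_sub, map_sub, ← res_comp, ← res_comp, ← res_comp]; simp [h₀])
      (by rw [map_sub, map_sub, ← res_comp, ← res_comp, ← res_comp]; simp [h₀])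
    have := congrArg (res F (biprod.lift f.unop g.unop)) hx
    simp only [map_sub, ← res_comp, Preadditive.comp_add, biprod.lift_fst, biprod.lift_snd,
      map_zero] at this
    rw [sub_sub, sub_eq_zero] at this
    exact this

/-- The morphism of presheaves corresponding to a section of an additive presheaf. -/
def homOfSection [F.Additive] {X : C} (x : F.obj (op X)) : preadditiveYoneda.obj X ⟶ F where
  app Y := AddCommGrpCat.ofHom (AddMonoidHom.mk' (fun f : unop Y ⟶ X => res F f x)
    (fun f g => res_add F f g x))
  naturality Y Y' f := by
    ext g
    exact res_comp F f.unop g x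

lemma homOfSection_app [F.Additive] {X Y : C} (x : F.obj (op X)) (f : Y ⟶ X) :
    (homOfSection F x).app (op Y) f = res F f x := rfl

lemma app_eq_res {X Y : C} (φ : preadditiveYoneda.obj X ⟶ F) (f : Y ⟶ X) :
    φ.app (op Y) f = res F f (φ.app (op X) (𝟙 X)) := by
  refine Eq.trans ?_ (app_res φ f (𝟙 X : (preadditiveYoneda.obj X).obj (op X)))
  exact congrArg (φ.app (op Y)) (Category.comp_id f).symm

end

variable [Preadditive C] {E : ObjectProperty (ShortComplex C)}

section LeftExact

variable {F : Cᵒᵖ ⥤ AddCommGrpCat.{v}} (hF : IsLeftExact E F)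
include hF

lemma IsLeftExact.eq_zero_of_res {X Y Z : C} {i : X ⟶ Y} {p : Y ⟶ Z} {w : i ≫ p = 0}
    (h : E (ShortComplex.mk i p w)) (x : F.obj (op Z)) (hx : res F p x = 0) : x = 0 :=
  (hF _ h).1 (hx.trans (map_zero (res F p)).symm)

lemma IsLeftExact.exists_of_res {X Y Z : C} {i : X ⟶ Y} {p : Y ⟶ Z} {w : i ≫ p = 0}
    (h : E (ShortComplex.mk i p w)) (x : F.obj (op Y)) (hx : res F i x = 0) :
    ∃ y, res F p y = x := ((hF _ h).2 x).1 hx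

lemma IsLeftExact.eq_zero_of_admissibleEpi {Y Z : C} {p : Y ⟶ Z}
    (h : AdmissibleEpi E p) (x : F.obj (op Z)) (hx : res F p x = 0) : x = 0 := by
  obtain ⟨_, _, _, h⟩ := h
  exact hF.eq_zero_of_res h x hx

lemma IsLeftExact.eq_of_admissibleEpi {Y Z : C} {p : Y ⟶ Z}
    (h : AdmissibleEpi E p) (x y : F.obj (op Z)) (hx : res F p x = res F p y) : x = y :=
  sub_eq_zero.1 (hF.eq_zero_of_admissibleEpi h _ (by rw [map_sub, hx, sub_self]))

lemma IsLeftExact.additive (hE : IsExactCategory E) : F.Additive := by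
  have := hE.hasBinaryBiproducts
  refine additive_of_res F (fun {X Y} x => ?_) (fun {Y} x h₁ h₂ => ?_)
  -- The cokernel `Z` of the identity has `F(Z) = 0`, and every zero morphism out of `X` factors
  -- through it.
  · obtain ⟨Z, p, w, h⟩ := hE.id_mono X
    have hp : p = 0 := by simpa using w
    obtain ⟨y, hy⟩ := hF.exists_of_res h (0 : F.obj (op X)) (by simp)
    have hZ : ∀ z : F.obj (op Z), z = 0 := fun z => by
      refine hF.eq_zero_of_res h z ?_
      have := ((hF _ h).2 (res F p z)).2 ⟨z, rfl⟩
      simpa [map_op_apply] using this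
    have : (0 : X ⟶ Y) = p ≫ (0 : Z ⟶ Y) := by simp
    rw [this, res_comp, hZ (res F 0 x), map_zero]
  · obtain ⟨y, rfl⟩ := hF.exists_of_res (hE.exact_inl_snd Y Y) x h₁
    rw [← res_comp, biprod.inr_snd, res_id] at h₂
    rw [h₂, map_zero]

/-- A section which lifts locally along an injective morphism into a left exact presheaf lifts. -/
lemma IsLeftExact.exists_of_locally {G : Cᵒᵖ ⥤ AddCommGrpCat.{v}} (hG : IsLeftExact E G)
    (φ : F ⟶ G) (hE : IsExactCategory E) (hφ : ∀ {Y : C} (x : F.obj (op Y)), φ.app _ x = 0 → x = 0)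
    {Y Q : C} (y : G.obj (op Y)) {q : Q ⟶ Y} (hq : AdmissibleEpi E q) (x : F.obj (op Q))
    (hx : φ.app _ x = res G q y) : ∃ x', φ.app _ x' = y := by
  have := hG.additive hE
  have hq' := hq
  obtain ⟨K, k, w, h⟩ := hq
  obtain ⟨x', rfl⟩ := hF.exists_of_res h x
    (hφ _ (by rw [app_res, hx, ← res_comp, w, res_zero]))
  exact ⟨x', hG.eq_of_admissibleEpi hq' _ _ (by rw [← app_res, hx])⟩

end LeftExact

lemma isLeftExact_yoneda (hE : IsExactCategory E) (X : C) :
    IsLeftExact E (preadditiveYoneda.obj X) := by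
  intro S hS
  have hK := hE.isKernelCokernelPair _ hS
  have := hK.epi_g
  refine ⟨fun (a : S.X₃ ⟶ X) (b : S.X₃ ⟶ X) hab => (cancel_epi S.g).1 hab,
    fun (a : S.X₂ ⟶ X) => ⟨fun ha => hK.exists_desc a ha, ?_⟩⟩
  rintro ⟨b : S.X₃ ⟶ X, rfl⟩
  exact (S.zero_assoc b).trans zero_comp

variable (E) in
/-- The presheaf `F` is the union of the subpresheaves generated by the sections `x i` over `X i`;
these are representable, and the transition maps are admissible monics. -/
structure IndPresentation (F : Cᵒᵖ ⥤ AddCommGrpCat.{v}) {I : Type*} [Preorder I] (X : I → C)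
    (x : ∀ i, F.obj (op (X i))) : Prop where
  eq_zero : ∀ {i : I} {Y : C} (f : Y ⟶ X i), res F f (x i) = 0 → f = 0
  trans : ∀ {i j : I}, i ≤ j → ∃ f : X i ⟶ X j, AdmissibleMono E f ∧ res F f (x j) = x i
  cover : ∀ {Y : C} (y : F.obj (op Y)), ∃ (i : I) (f : Y ⟶ X i), res F f (x i) = y

namespace IndPresentation

variable {F : Cᵒᵖ ⥤ AddCommGrpCat.{v}} {I : Type*} [Preorder I] {X : I → C}
    {x : ∀ i, F.obj (op (X i))} (h : IndPresentation E F X x)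
include h

lemma eq_of_res [F.Additive] {i : I} {Y : C} {f g : Y ⟶ X i} (hfg : res F f (x i) = res F g (x i)) :
    f = g :=
  sub_eq_zero.1 (h.eq_zero _ (by rw [res_sub, hfg, sub_self]))

lemma exists_of_le {Y : C} {y : F.obj (op Y)} {i : I} {f : Y ⟶ X i} (hf : res F f (x i) = y)
    {j : I} (hij : i ≤ j) : ∃ f : Y ⟶ X j, res F f (x j) = y := by
  obtain ⟨g, -, hg⟩ := h.trans hij
  exact ⟨f ≫ g, by rw [res_comp, hg, hf]⟩

lemma exists_ge {Y : C} (y : F.obj (op Y)) [IsDirectedOrder I] (i : I) :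
    ∃ j, i ≤ j ∧ ∃ f : Y ⟶ X j, res F f (x j) = y := by
  obtain ⟨j, f, hf⟩ := h.cover y
  obtain ⟨k, hk₁, hk₂⟩ := exists_ge_ge i j
  exact ⟨k, hk₁, h.exists_of_le hf hk₂⟩

lemma of_iso {G : Cᵒᵖ ⥤ AddCommGrpCat.{v}} (e : F ≅ G) :
    IndPresentation E G X (fun i => e.hom.app _ (x i)) where
  eq_zero {i Y} f hf := by
    rw [← app_res] at hf
    refine h.eq_zero f ?_
    simpa using congrArg (e.inv.app (op Y)) hf
  trans hij := by
    obtain ⟨f, hf, hf'⟩ := h.trans hij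
    exact ⟨f, hf, by rw [← app_res, hf']⟩
  cover {Y} y := by
    obtain ⟨i, f, hf⟩ := h.cover (e.inv.app _ y)
    exact ⟨i, f, by rw [← app_res, hf]; simp⟩

/-- Each section is an actual morphism to some `X i`, and vanishes only if that morphism does. Left
exactness thus reduces to that of representable presheaves. -/
lemma isLeftExact [F.Additive] (hE : IsExactCategory E) : IsLeftExact E F := by
  intro S hS
  have hK := hE.isKernelCokernelPair _ hS
  have := hK.epi_g
  refine ⟨(injective_iff_map_eq_zero (res F S.g)).2 fun y hy => ?_, fun y => ⟨fun hy => ?_, ?_⟩⟩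
  · obtain ⟨i, f, rfl⟩ := h.cover y
    rw [← res_comp] at hy
    rw [(Preadditive.epi_iff_cancel_zero S.g).1 inferInstance _ f (h.eq_zero _ hy), res_zero]
  · obtain ⟨i, f, rfl⟩ := h.cover y
    rw [map_op_apply, ← res_comp] at hy
    obtain ⟨l, rfl⟩ := hK.exists_desc f (h.eq_zero _ hy)
    exact ⟨res F l (x i), (res_comp F S.g l (x i)).symm⟩
  · rintro ⟨z, rfl⟩
    rw [map_op_apply, map_op_apply, ← res_comp, S.zero, res_zero]

end IndPresentation

namespace AdmissibleIndDiagram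

variable (D : AdmissibleIndDiagram E)

instance : IsDirectedOrder D.I := D.directed

instance : Nonempty D.I := D.nonempty

/-- The section of the presheaf of `D` over `D.X.obj i` given by the identity. -/
noncomputable def gen (i : D.I) : D.presheaf.obj (op (D.X.obj i)) :=
  (colimit.ι (D.X ⋙ preadditiveYoneda) i).app (op (D.X.obj i)) (𝟙 (D.X.obj i))

lemma ι_app {i : D.I} {Y : C} (f : Y ⟶ D.X.obj i) :
    (colimit.ι (D.X ⋙ preadditiveYoneda) i).app (op Y) f = res D.presheaf f (D.gen i) :=
  app_eq_res _ _ f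

lemma res_gen {i j : D.I} (f : i ⟶ j) :
    res D.presheaf (D.X.map f) (D.gen j) = D.gen i := by
  rw [← D.ι_app, gen, ← colimit.w (D.X ⋙ preadditiveYoneda) f]
  exact congrArg ((colimit.ι (D.X ⋙ preadditiveYoneda) j).app _) (Category.id_comp _).symm

/-- The sections over `Y` of the presheaf of `D` are a colimit of the groups `Y ⟶ D.X.obj i`. -/
noncomputable def isColimitSections (Y : C) :
    IsColimit (((evaluation Cᵒᵖ AddCommGrpCat.{v}).obj (op Y)).mapCocone
      (colimit.cocone (D.X ⋙ preadditiveYoneda))) :=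
  isColimitOfPreserves _ (colimit.isColimit _)

lemma exists_res_gen {Y : C} (y : D.presheaf.obj (op Y)) :
    ∃ (i : D.I) (f : Y ⟶ D.X.obj i), res D.presheaf f (D.gen i) = y := by
  obtain ⟨i, f, hf⟩ := Concrete.isColimit_exists_rep _ (D.isColimitSections Y) y
  exact ⟨i, f, (D.ι_app f).symm.trans hf⟩

lemma res_gen_add {i : D.I} {Y : C} (f g : Y ⟶ D.X.obj i) :
    res D.presheaf (f + g) (D.gen i) = res D.presheaf f (D.gen i) + res D.presheaf g (D.gen i) := by
  rw [← D.ι_app, ← D.ι_app, ← D.ι_app]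
  exact map_add ((colimit.ι (D.X ⋙ preadditiveYoneda) i).app (op Y)).hom _ _

instance : D.presheaf.Additive where
  map_add {Y X f g} := by
    ext x
    obtain ⟨i, h, rfl⟩ := D.exists_res_gen x
    change res D.presheaf (f.unop + g.unop) _ =
      res D.presheaf f.unop _ + res D.presheaf g.unop _
    rw [← res_comp, ← res_comp, ← res_comp, Preadditive.add_comp, res_gen_add]

lemma presentation (hE : IsExactCategory E) :
    IndPresentation E D.presheaf D.X.obj D.gen where
  eq_zero {i Y} f hf := by
    have h0 : res D.presheaf f (D.gen i) = res D.presheaf (0 : Y ⟶ D.X.obj i) (D.gen i) := by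
      rw [hf, res_zero]
    rw [← D.ι_app, ← D.ι_app] at h0
    obtain ⟨k, a, b, h⟩ := Concrete.isColimit_exists_of_rep_eq _ (D.isColimitSections Y) _ _ h0
    have h' : f ≫ D.X.map a = 0 ≫ D.X.map b := h
    have := hE.mono_of_admissibleMono (D.admissible a)
    rwa [zero_comp, ← zero_comp (f := D.X.map a), cancel_mono] at h'
  trans hij := ⟨D.X.map (homOfLE hij), D.admissible _, D.res_gen _⟩
  cover := D.exists_res_gen

lemma exists_hom {G : Cᵒᵖ ⥤ AddCommGrpCat.{v}} [G.Additive] (y : ∀ i, G.obj (op (D.X.obj i)))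
    (hy : ∀ {i j : D.I} (f : i ⟶ j), res G (D.X.map f) (y j) = y i) :
    ∃ φ : D.presheaf ⟶ G, ∀ i, φ.app _ (D.gen i) = y i := by
  let c : Cocone (D.X ⋙ preadditiveYoneda) :=
    { pt := G
      ι :=
        { app := fun i => homOfSection G (y i)
          naturality := fun i j f => by
            ext Y g
            exact (res_comp G (show unop Y ⟶ D.X.obj i from g) (D.X.map f) (y j)).trans
              (congrArg (res G (show unop Y ⟶ D.X.obj i from g)) (hy f)) } }
  exact ⟨colimit.desc _ c, fun i => (congrArg (fun φ : preadditiveYoneda.obj (D.X.obj i) ⟶ G =>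
    φ.app (op (D.X.obj i)) (𝟙 (D.X.obj i))) (colimit.ι_desc c i)).trans (res_id G _)⟩

lemma hom_ext {G : Cᵒᵖ ⥤ AddCommGrpCat.{v}} {φ ψ : D.presheaf ⟶ G}
    (h : ∀ i, φ.app _ (D.gen i) = ψ.app _ (D.gen i)) : φ = ψ := by
  ext Y y
  obtain ⟨i, f, rfl⟩ := D.exists_res_gen (Y := unop Y) y
  exact (app_res φ f _).trans ((congrArg (res G f) (h i)).trans (app_res ψ f _).symm)

end AdmissibleIndDiagram

/-- A presentation by sections defines an admissible Ind-diagram. -/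
lemma IndPresentation.exists_diagram {F : Cᵒᵖ ⥤ AddCommGrpCat.{v}} [F.Additive] {I : Type v}
    [PartialOrder I] [IsDirectedOrder I] [Nonempty I] {X : I → C}
    {x : ∀ i, F.obj (op (X i))} (h : IndPresentation E F X x) :
    ∃ D : AdmissibleIndDiagram E, D.I = I ∧ Nonempty (F ≅ D.presheaf) := by
  choose t ht htx using @h.trans
  let D : AdmissibleIndDiagram E :=
    { I := I
      directed := inferInstance
      nonempty := inferInstance
      X :=
        { obj := X
          map := fun f => t f.le
          -- A transition map is determined by its effect on sections, so arbitrary choices are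
          -- automatically functorial.
          map_id := fun i => h.eq_of_res (by rw [htx, res_id])
          map_comp := fun f g => h.eq_of_res (by rw [res_comp, htx, htx, htx]) }
      admissible := fun f => ht f.le }
  obtain ⟨φ, hφ⟩ := D.exists_hom x (fun f => htx f.le)
  have : IsIso φ := by
    rw [NatTrans.isIso_iff_isIso_app]
    intro Y
    rw [ConcreteCategory.isIso_iff_bijective]
    refine ⟨(injective_iff_map_eq_zero (φ.app Y).hom).2 fun y hy => ?_, fun y => ?_⟩
    · obtain ⟨i, f, rfl⟩ := D.exists_res_gen (Y := unop Y) y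
      have := (app_res φ f _).symm.trans hy
      rw [hφ] at this
      rw [h.eq_zero f this, res_zero]
    · obtain ⟨i, f, hf⟩ := h.cover (Y := unop Y) y
      exact ⟨res D.presheaf f (D.gen i), (app_res φ f _).trans ((congrArg _ (hφ i)).trans hf)⟩
  exact ⟨D, rfl, ⟨(asIso φ).symm⟩⟩

end Presheaves
end ExactCat

namespace ExactCat

/-! ### Left exact presheaves as sheaves; exactness in `Lex E` as local exactness -/

section Sheaves

open Opposite
open scoped ZeroObject

variable {C : Type u} [Category.{v} C] [Preadditive C] {E : ObjectProperty (ShortComplex C)}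

lemma IsExactCategory.exists_refinement (hE : IsExactCategory E) {Q Y Y' : C} {q : Q ⟶ Y}
    (hq : AdmissibleEpi E q) (f : Y' ⟶ Y) :
    ∃ (Q' : C) (q' : Q' ⟶ Y') (f' : Q' ⟶ Q), AdmissibleEpi E q' ∧ f' ≫ q = q' ≫ f := by
  obtain ⟨Q', f', q', hP, hq'⟩ := hE.pullback_epi q f hq
  exact ⟨Q', q', f', hq', hP.w⟩

variable (E) in
/-- The morphisms `f` and `g` of presheaves form a short exact sequence, where the surjectivity of
`g` is required only locally, on the source of an admissible epic. -/
structure IsLocallyExact {X F Z : Cᵒᵖ ⥤ AddCommGrpCat.{v}} (f : X ⟶ F) (g : F ⟶ Z) : Prop where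
  eq_zero : ∀ {Y : C} (x : X.obj (op Y)), f.app _ x = 0 → x = 0
  zero : ∀ {Y : C} (x : X.obj (op Y)), g.app _ (f.app _ x) = 0
  exact : ∀ {Y : C} (y : F.obj (op Y)), g.app _ y = 0 → ∃ x, f.app _ x = y
  exists_lift : ∀ {Y : C} (z : Z.obj (op Y)), ∃ (Q : C) (q : Q ⟶ Y) (y : F.obj (op Q)),
    AdmissibleEpi E q ∧ g.app _ y = res Z q z

lemma IsLocallyExact.exists_hom {X F Z : Cᵒᵖ ⥤ AddCommGrpCat.{v}} {f : X ⟶ F} {g : F ⟶ Z}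
    (h : IsLocallyExact E f g) {T : Cᵒᵖ ⥤ AddCommGrpCat.{v}} (k : T ⟶ F) (hk : k ≫ g = 0) :
    ∃ l, l ≫ f = k := by
  have hk' {Y : C} (t : T.obj (op Y)) : g.app _ (k.app _ t) = 0 :=
    ConcreteCategory.congr_hom (congr_app hk (op Y)) t
  have inj {Y : C} {x y : X.obj (op Y)} (hxy : f.app _ x = f.app _ y) : x = y :=
    sub_eq_zero.1 (h.eq_zero _ (by rw [map_sub, hxy, sub_self]))
  choose l hl using fun (Y : C) (t : T.obj (op Y)) => h.exact _ (hk' t)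
  refine ⟨{ app := fun Y => AddCommGrpCat.ofHom (AddMonoidHom.mk' (l (unop Y)) (fun a b =>
              inj (by rw [map_add, hl, hl, hl, map_add])))
            naturality := fun Y Y' a => ?_ }, ?_⟩
  · ext t
    refine inj ((hl (unop Y') (res T a.unop t)).trans ?_)
    exact (app_res k a.unop t).trans
      ((congrArg (res F a.unop) (hl (unop Y) t)).symm.trans (app_res f a.unop _).symm)
  · ext Y t
    exact hl (unop Y) t

/-- The left exact subpresheaf of the sections which lift locally along `φ`. -/
def localImage (hE : IsExactCategory E) {F G : Cᵒᵖ ⥤ AddCommGrpCat.{v}} (φ : F ⟶ G) (Y : C) :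
    AddSubgroup (G.obj (op Y)) where
  carrier := {z | ∃ (Q : C) (q : Q ⟶ Y) (y : F.obj (op Q)), AdmissibleEpi E q ∧
    φ.app _ y = res G q z}
  zero_mem' := ⟨Y, 𝟙 Y, 0, hE.id_epi Y, by simp⟩
  add_mem' := by
    rintro a b ⟨Q, q, y, hq, hy⟩ ⟨Q', q', y', hq', hy'⟩
    obtain ⟨R, r, r', hr, hrr⟩ := hE.exists_refinement hq q'
    refine ⟨R, r ≫ q', res F r' y + res F r y', hE.comp_epi _ _ hr hq', ?_⟩
    rw [map_add, map_add, app_res, app_res, hy, hy', ← res_comp, ← res_comp, hrr]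
  neg_mem' := by
    rintro a ⟨Q, q, y, hq, hy⟩
    exact ⟨Q, q, -y, hq, by rw [map_neg, map_neg, hy]⟩

lemma res_mem_localImage (hE : IsExactCategory E) {F G : Cᵒᵖ ⥤ AddCommGrpCat.{v}} (φ : F ⟶ G)
    {Y Y' : C} (f : Y' ⟶ Y) {z : G.obj (op Y)} (hz : z ∈ localImage hE φ Y) :
    res G f z ∈ localImage hE φ Y' := by
  obtain ⟨Q, q, y, hq, hy⟩ := hz
  obtain ⟨R, r, r', hr, hrr⟩ := hE.exists_refinement hq f
  exact ⟨R, r, res F r' y, hr, by rw [app_res, hy, ← res_comp, ← res_comp, hrr]⟩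

/-- The presheaf of the sections which lift locally along `φ`. -/
def localImagePresheaf (hE : IsExactCategory E) {F G : Cᵒᵖ ⥤ AddCommGrpCat.{v}} (φ : F ⟶ G) :
    Cᵒᵖ ⥤ AddCommGrpCat.{v} where
  obj Y := AddCommGrpCat.of (localImage hE φ (unop Y))
  map f := AddCommGrpCat.ofHom (((res G f.unop).comp (AddSubgroup.subtype _)).codRestrict _
    (fun z => res_mem_localImage hE φ f.unop z.2))
  map_id Y := by
    ext z
    exact res_id G z.1
  map_comp f g := by
    ext z
    exact res_comp G g.unop f.unop z.1

/-- The inclusion of the presheaf of the sections which lift locally along `φ`. -/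
def localImageι (hE : IsExactCategory E) {F G : Cᵒᵖ ⥤ AddCommGrpCat.{v}} (φ : F ⟶ G) :
    localImagePresheaf hE φ ⟶ G where
  app _ := AddCommGrpCat.ofHom (AddSubgroup.subtype _)
  naturality _ _ _ := rfl

/-- The corestriction of `φ` to the sections which lift locally along it. -/
def toLocalImage (hE : IsExactCategory E) {F G : Cᵒᵖ ⥤ AddCommGrpCat.{v}} (φ : F ⟶ G) :
    F ⟶ localImagePresheaf hE φ where
  app Y := AddCommGrpCat.ofHom ((φ.app Y).hom.codRestrict (localImage hE φ (unop Y))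
    (fun y => ⟨unop Y, 𝟙 _, y, hE.id_epi _, (res_id _ _).symm⟩))
  naturality _ _ f := by
    ext y
    exact Subtype.ext (app_res φ f.unop y)

/-- Lifting locally is a local property: if a section over `S.X₂` lifts along `q`, then its descent
to `S.X₃` lifts along `q ≫ S.g`, again an admissible epic. -/
lemma isLeftExact_localImagePresheaf (hE : IsExactCategory E) {F G : Cᵒᵖ ⥤ AddCommGrpCat.{v}}
    (φ : F ⟶ G) (hG : IsLeftExact E G) : IsLeftExact E (localImagePresheaf hE φ) := by
  intro S hS
  refine ⟨fun z z' h => Subtype.ext ((hG S hS).1 (congrArg Subtype.val h)),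
    fun z => ⟨fun h => ?_, ?_⟩⟩
  · obtain ⟨z', hz'⟩ := ((hG S hS).2 z.1).1 (congrArg Subtype.val h)
    obtain ⟨Q, q, y, hq, hy⟩ := z.2
    exact ⟨⟨z', Q, q ≫ S.g, y, hE.comp_epi _ _ hq ⟨_, _, _, hS⟩, by
      rw [hy, res_comp]; exact congrArg _ hz'.symm⟩, Subtype.ext hz'⟩
  · rintro ⟨z', rfl⟩
    exact Subtype.ext (((hG S hS).2 _).2 ⟨z'.1, rfl⟩)

/-- The exact sequences of `Lex E` are locally exact. -/
lemma isLocallyExact_of_lexExact (hE : IsExactCategory E) {S : ShortComplex (Lex E)}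
    (hS : lexExact E S) : IsLocallyExact E S.f.hom S.g.hom := by
  have hK : IsKernelCokernelPair S := hS
  have := hK.mono_f
  have := hK.epi_g
  have (F : Lex E) : F.obj.Additive := F.property.additive hE
  let y (X : C) : Lex E := ⟨preadditiveYoneda.obj X, isLeftExact_yoneda hE X⟩
  let h (X : C) (F : Lex E) (x : F.obj.obj (op X)) : y X ⟶ F :=
    ObjectProperty.homMk (homOfSection F.obj x)
  refine ⟨fun {Y} x hx => ?_, fun {Y} x => ?_, fun {Y} z hz => ?_, ?_⟩
  · have : h Y _ x ≫ S.f = 0 := by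
      ext T t
      change S.f.hom.app _ (res _ _ _) = _
      exact (app_res _ _ _).trans ((congrArg _ hx).trans (map_zero _))
    exact (res_id _ _).symm.trans (congrArg (fun φ => φ.hom.app (op Y) (𝟙 Y))
      ((Preadditive.mono_iff_cancel_zero S.f).1 inferInstance _ _ this))
  · exact ConcreteCategory.congr_hom (congr_app (congrArg InducedCategory.Hom.hom S.zero) (op Y)) x
  · obtain ⟨l, hl⟩ := hK.exists_lift (h Y _ z) (by
      ext T t
      change S.g.hom.app _ (res _ _ _) = _
      exact (app_res _ _ _).trans ((congrArg _ hz).trans (map_zero _)))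
    exact ⟨l.hom.app (op Y) (𝟙 Y),
      (congrArg (fun φ => φ.hom.app (op Y) (𝟙 Y)) hl).trans (res_id _ _)⟩
  -- The cokernel `S.g` factors through its local image `J`, so the cokernel property splits the
  -- inclusion of `J`, and every section of `S.X₃` lifts locally.
  · let J : Lex E := ⟨localImagePresheaf hE S.g.hom,
      isLeftExact_localImagePresheaf hE _ S.X₃.property⟩
    let ι : J ⟶ S.X₃ := ObjectProperty.homMk (localImageι hE S.g.hom)
    let π : S.X₂ ⟶ J := ObjectProperty.homMk (toLocalImage hE S.g.hom)
    have hπ : π ≫ ι = S.g := rfl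
    obtain ⟨l, hl⟩ := hK.exists_desc π (by
      ext T t
      exact Subtype.ext (ConcreteCategory.congr_hom
        (congr_app (congrArg InducedCategory.Hom.hom S.zero) T) t))
    have hl' : l ≫ ι = 𝟙 _ := by rw [← cancel_epi S.g, reassoc_of% hl, hπ, Category.comp_id]
    intro Y z
    obtain ⟨Q, q, y, hq, hy⟩ := (l.hom.app _ z).2
    exact ⟨Q, q, y, hq, hy.trans (congrArg (res _ q)
      (congrArg (fun φ => φ.hom.app (op Y) z) hl'))⟩

variable (E) in
/-- The Grothendieck topology whose covering sieves are those which contain an admissible epic. -/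
def admissibleTopology (hE : IsExactCategory E) : GrothendieckTopology C where
  sieves X := {S | ∃ (Q : C) (q : Q ⟶ X), AdmissibleEpi E q ∧ S q}
  top_mem' X := ⟨X, 𝟙 X, hE.id_epi X, trivial⟩
  pullback_stable' X Y S f := by
    rintro ⟨Q, q, hq, hS⟩
    obtain ⟨R, r, r', hr, hrr⟩ := hE.exists_refinement hq f
    exact ⟨R, r, hr, by simpa [← hrr] using S.downward_closed hS r'⟩
  transitive' X S := by
    rintro ⟨Q, q, hq, hS⟩ R hR
    obtain ⟨Q', q', hq', hR'⟩ := hR hS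
    exact ⟨Q', q' ≫ q, hE.comp_epi _ _ hq' hq, hR'⟩

variable (hE : IsExactCategory E)

lemma IsLeftExact.isSheaf {F : Cᵒᵖ ⥤ AddCommGrpCat.{v}} (hF : IsLeftExact E F) :
    Presheaf.IsSheaf (admissibleTopology E hE) F := by
  have := hF.additive hE
  rintro T X S ⟨Q, q, hq, hSq⟩ x hx
  have inj {Y : C} {Q : C} {q : Q ⟶ Y} (hq : AdmissibleEpi E q) {a b : T ⟶ F.obj (op Y)}
      (h : a ≫ F.map q.op = b ≫ F.map q.op) : a = b := by
    ext t
    exact hF.eq_of_admissibleEpi hq _ _ (ConcreteCategory.congr_hom h t)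
  obtain ⟨K, k, w, h⟩ := hq
  have hq : AdmissibleEpi E q := ⟨K, k, w, h⟩
  let xq : T ⟶ F.obj (op Q) := x q hSq
  -- Compatibility of the family, applied to `k ≫ q = 0 ≫ q`.
  have hk : ∀ t : T, res F k (xq t) = 0 := fun t => by
    have := ConcreteCategory.congr_hom (hx k 0 hSq hSq (by simp [w])) t
    exact this.trans (res_zero F _)
  choose l hl using fun t : T => hF.exists_of_res h _ (hk t)
  let a : T ⟶ F.obj (op X) := AddCommGrpCat.ofHom (AddMonoidHom.mk' l (fun s t =>
    hF.eq_of_admissibleEpi hq _ _ (by rw [map_add, hl, hl, hl, map_add])))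
  have ha : a ≫ F.map q.op = xq := by
    ext t
    exact hl t
  refine ⟨a, fun Y f hf => ?_, fun b hb => inj hq ((hb q hSq).trans ha.symm)⟩
  obtain ⟨R, r, r', hr, hrr⟩ := hE.exists_refinement hq f
  refine inj hr ?_
  change (a ≫ F.map f.op) ≫ F.map r.op = _
  rw [Category.assoc, ← F.map_comp, ← op_comp, ← hrr, op_comp, F.map_comp, reassoc_of% ha]
  exact hx r' r hSq hf hrr

/-- Two maps with the same composite with `S.g` differ by a map through `S.f`. By additivity, a
section over `S.X₂` is therefore a compatible family as soon as `S.f` kills it. -/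
lemma isLeftExact_of_isSheaf {F : Cᵒᵖ ⥤ AddCommGrpCat.{v}} [F.Additive] [EssentiallySmall.{v} C]
    (hF : Presheaf.IsSheaf (admissibleTopology E hE) F) : IsLeftExact E F := by
  intro S hS
  have h := (isSheaf_iff_isSheaf_of_type _ _).1
    (GrothendieckTopology.HasSheafCompose.isSheaf (F := forget AddCommGrpCat.{v}) F hF)
    (Sieve.generate (Presieve.singleton S.g))
    ⟨S.X₂, S.g, ⟨_, _, _, hS⟩, Sieve.le_generate _ _ _ (Presieve.singleton_self _)⟩
  rw [← Presieve.isSheafFor_iff_generate] at h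
  refine ⟨Presieve.isSeparatedFor_singleton.1 h.isSeparatedFor, fun y => ⟨fun hy => ?_, ?_⟩⟩
  · obtain ⟨z, hz, -⟩ := Presieve.isSheafFor_singleton.1 h y (fun {Z} a b hab => by
      obtain ⟨c, hc⟩ := (hE.isKernelCokernelPair _ hS).exists_lift (a - b) (by simp [hab])
      change res F a y = res F b y
      rw [← sub_eq_zero, ← res_sub, ← hc, res_comp]
      exact (congrArg _ hy).trans (map_zero _))
    exact ⟨z, hz⟩
  · rintro ⟨z, rfl⟩
    rw [map_op_apply, map_op_apply, ← res_comp, S.zero, res_zero]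

/-- Left exact presheaves are sheaves. -/
abbrev lexToSheaf : Lex E ⥤ Sheaf (admissibleTopology E hE) AddCommGrpCat.{v} :=
  ObjectProperty.ιOfLE (fun _ hF => IsLeftExact.isSheaf hE hF)

instance : (lexToSheaf hE).Additive where

variable [EssentiallySmall.{v} C]

/-- Essential smallness gives sheafification, and with it the abelian category of sheaves. -/
instance : HasSheafify (admissibleTopology E hE) AddCommGrpCat.{v} :=
  hasSheafifyEssentiallySmallSite.{v} _ _

lemma shortExact_of_isLocallyExact {S : ShortComplex (Lex E)}
    (hS : IsLocallyExact E S.f.hom S.g.hom) : (S.map (lexToSheaf hE)).ShortExact := by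
  have hm : Mono (S.map (lexToSheaf hE)).f := by
    refine Preadditive.mono_of_cancel_zero _ fun k hk => ?_
    ext Y t
    exact hS.eq_zero (Y := unop Y) (k.hom.app Y t)
      (ConcreteCategory.congr_hom (congr_app (congrArg InducedCategory.Hom.hom hk) Y) t)
  have he : Epi (S.map (lexToSheaf hE)).g := by
    have : Sheaf.IsLocallySurjective (S.map (lexToSheaf hE)).g := ⟨fun {Y} z => by
      obtain ⟨Q, q, y, hq, hy⟩ := hS.exists_lift z
      exact ⟨Q, q, hq, y, hy⟩⟩
    infer_instance
  refine { exact := ShortComplex.exact_of_f_is_kernel _ (KernelFork.IsLimit.ofι' _ _ ?_) }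
  intro T k hk
  exact ⟨ObjectProperty.homMk (hS.exists_hom k.hom (congrArg InducedCategory.Hom.hom hk)).choose,
    InducedCategory.hom_ext
      (hS.exists_hom k.hom (congrArg InducedCategory.Hom.hom hk)).choose_spec⟩

lemma isKernelCokernelPair_of_map {B A : Type*} [Category* B] [Category* A] [Preadditive B]
    [Abelian A] (Φ : B ⥤ A) [Φ.Additive] [Φ.Full] [Φ.Faithful] {S : ShortComplex B}
    (hS : (S.map Φ).ShortExact) : IsKernelCokernelPair S := by
  have := hS.mono_f
  have := hS.epi_g
  have : Mono S.f := Φ.mono_of_mono_map hS.mono_f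
  have : Epi S.g := Φ.epi_of_epi_map hS.epi_g
  refine ⟨⟨KernelFork.IsLimit.ofι' _ _ fun k hk => ⟨Φ.preimage (hS.exact.lift (Φ.map k) ?_),
    Φ.map_injective ?_⟩⟩, ⟨CokernelCofork.IsColimit.ofπ' _ _ fun k hk =>
    ⟨Φ.preimage (hS.exact.desc (Φ.map k) ?_), Φ.map_injective ?_⟩⟩⟩
  · exact (Φ.map_comp k S.g).symm.trans (by rw [hk, Φ.map_zero]; rfl)
  · exact (Φ.map_comp _ _).trans ((congrArg (· ≫ Φ.map S.f) (Φ.map_preimage _)).trans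
      (hS.exact.lift_f _ _))
  · exact (Φ.map_comp S.f k).symm.trans (by rw [hk, Φ.map_zero]; rfl)
  · exact (Φ.map_comp _ _).trans ((congrArg (Φ.map S.g ≫ ·) (Φ.map_preimage _)).trans
      (hS.exact.g_desc _ _))

lemma lexExact_iff {S : ShortComplex (Lex E)} :
    lexExact E S ↔ (S.map (lexToSheaf hE)).ShortExact :=
  ⟨fun h => shortExact_of_isLocallyExact hE (isLocallyExact_of_lexExact hE h),
    isKernelCokernelPair_of_map _⟩

include hE in
lemma lexExact_iff_isLocallyExact {S : ShortComplex (Lex E)} :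
    lexExact E S ↔ IsLocallyExact E S.f.hom S.g.hom :=
  ⟨isLocallyExact_of_lexExact hE,
    fun h => (lexExact_iff hE).2 (shortExact_of_isLocallyExact hE h)⟩

omit [EssentiallySmall.{v} C] in
lemma eq_zero_of_res_biprod {F : Cᵒᵖ ⥤ AddCommGrpCat.{v}} [F.Additive] {Y Y' : C}
    [HasBinaryBiproduct Y Y'] (x : F.obj (op (Y ⊞ Y'))) (h₁ : res F biprod.inl x = 0)
    (h₂ : res F biprod.inr x = 0) : x = 0 := by
  rw [← res_id F x, ← biprod.total, res_add, res_comp, res_comp, h₁, h₂, map_zero, map_zero,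
    add_zero]

omit [EssentiallySmall.{v} C] in
lemma eq_zero_of_zero {F : Cᵒᵖ ⥤ AddCommGrpCat.{v}} [F.Additive] [HasZeroObject C]
    (x : F.obj (op (0 : C))) : x = 0 := by
  rw [← res_id F x, id_zero, res_zero]

/-- An extension of left exact presheaves in the category of sheaves is left exact. -/
lemma isLeftExact_of_shortExact
    {S : ShortComplex (Sheaf (admissibleTopology E hE) AddCommGrpCat.{v})}
    (hS : S.ShortExact) (h₁ : IsLeftExact E S.X₁.obj) (h₃ : IsLeftExact E S.X₃.obj) :
    IsLeftExact E S.X₂.obj := by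
  have := h₁.additive hE
  have := h₃.additive hE
  have := hE.hasBinaryBiproducts
  have := hS.mono_f
  have hinj {Y : C} (x : S.X₁.obj.obj (op Y)) (hx : S.f.hom.app _ x = 0) : x = 0 := by
    have : Mono (((sheafToPresheaf _ _).map S.f).app (op Y)) := inferInstance
    exact (injective_iff_map_eq_zero _).1 ((AddCommGrpCat.mono_iff_injective _).1 this) x hx
  have hex {Y : C} (y : S.X₂.obj.obj (op Y)) (hy : S.g.hom.app _ y = 0) :
      ∃ x, S.f.hom.app _ x = y :=
    (ShortComplex.ab_exact_iff _).1 (hS.exact.map_of_mono_of_preservesKernel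
      (sheafToPresheaf _ _ ⋙ (evaluation _ _).obj (op Y)) inferInstance inferInstance) y hy
  -- A sheaf need not be additive, as nonzero constant presheaves show, but additivity passes to
  -- extensions.
  have : S.X₂.obj.Additive := by
    have := hE.hasFiniteBiproducts
    have : HasZeroObject C := hasZeroObject_of_hasFiniteBiproducts C
    refine additive_of_res _ (fun {X Y} x => ?_) (fun {Y} x h₁ h₂ => ?_)
    · have h0 (w : S.X₂.obj.obj (op (0 : C))) : w = 0 := by
        obtain ⟨v, rfl⟩ := hex w (eq_zero_of_zero _)
        rw [eq_zero_of_zero v, map_zero]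
      rw [← comp_zero (f := (0 : X ⟶ 0)), res_comp, h0 (res _ _ x), map_zero]
    · obtain ⟨v, rfl⟩ := hex x (eq_zero_of_res_biprod _
        (by rw [← app_res, h₁, map_zero]) (by rw [← app_res, h₂, map_zero]))
      rw [← app_res] at h₁ h₂
      rw [eq_zero_of_res_biprod v (hinj _ h₁) (hinj _ h₂), map_zero]
  exact isLeftExact_of_isSheaf hE S.X₂.property

end Sheaves
end ExactCat

namespace ExactCat

/-! ### Extension-closed subcategories of abelian categories -/

section ExtensionClosed

variable {A : Type*} [Category* A] [Abelian A]

lemma shortExact_of_isos {X Y Z X' Y' Z' : A} {i : X ⟶ Y} {p : Y ⟶ Z} {w : i ≫ p = 0}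
    (h : (ShortComplex.mk i p w).ShortExact) {i' : X' ⟶ Y'} {p' : Y' ⟶ Z'} (w' : i' ≫ p' = 0)
    (e₁ : X ≅ X') (e₂ : Y ≅ Y') (e₃ : Z ≅ Z') (h₁ : e₁.hom ≫ i' = i ≫ e₂.hom)
    (h₂ : e₂.hom ≫ p' = p ≫ e₃.hom) : (ShortComplex.mk i' p' w').ShortExact :=
  ShortComplex.shortExact_of_iso (S₁ := ShortComplex.mk i p w) (S₂ := ShortComplex.mk i' p' w')
    (ShortComplex.isoMk e₁ e₂ e₃ h₁ h₂) h

lemma ShortExact.exists_lift {X Y Z : A} {i : X ⟶ Y} {p : Y ⟶ Z} {w : i ≫ p = 0}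
    (h : (ShortComplex.mk i p w).ShortExact) {T : A} (k : T ⟶ Y) (hk : k ≫ p = 0) :
    ∃ l, l ≫ i = k :=
  have := h.mono_f
  ⟨h.exact.lift k hk, h.exact.lift_f k hk⟩

lemma ShortExact.exists_desc {X Y Z : A} {i : X ⟶ Y} {p : Y ⟶ Z} {w : i ≫ p = 0}
    (h : (ShortComplex.mk i p w).ShortExact) {T : A} (k : Y ⟶ T) (hk : i ≫ k = 0) :
    ∃ l, p ≫ l = k :=
  have := h.epi_g
  ⟨h.exact.desc k hk, h.exact.g_desc k hk⟩

lemma shortExact_of_exists_lift {X Y Z : A} {i : X ⟶ Y} {p : Y ⟶ Z} (w : i ≫ p = 0)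
    (hi : Mono i) (hp : Epi p) (hl : ∀ {T : A} (k : T ⟶ Y), k ≫ p = 0 → ∃ l, l ≫ i = k) :
    (ShortComplex.mk i p w).ShortExact where
  exact := ShortComplex.exact_of_f_is_kernel _ (KernelFork.IsLimit.ofι' _ _ fun k hk =>
    ⟨(hl k hk).choose, (hl k hk).choose_spec⟩)

lemma shortExact_of_exists_desc {X Y Z : A} {i : X ⟶ Y} {p : Y ⟶ Z} (w : i ≫ p = 0)
    (hi : Mono i) (hp : Epi p) (hl : ∀ {T : A} (k : Y ⟶ T), i ≫ k = 0 → ∃ l, p ≫ l = k) :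
    (ShortComplex.mk i p w).ShortExact where
  exact := ShortComplex.exact_of_g_is_cokernel _ (CokernelCofork.IsColimit.ofπ' _ _ fun k hk =>
    ⟨(hl k hk).choose, (hl k hk).choose_spec⟩)

/-- A pushout of a short exact sequence along a morphism out of its kernel is short exact. -/
lemma shortExact_of_isPushout {X Y Z X' Y' : A} {i : X ⟶ Y} {p : Y ⟶ Z} {w : i ≫ p = 0}
    (h : (ShortComplex.mk i p w).ShortExact) {f : X ⟶ X'} {g : Y ⟶ Y'} {i' : X' ⟶ Y'} {p' : Y' ⟶ Z}
    (hP : IsPushout i f g i') (hg : g ≫ p' = p) (w' : i' ≫ p' = 0) :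
    (ShortComplex.mk i' p' w').ShortExact := by
  have hi : Mono i := h.mono_f
  have hp : Epi p := h.epi_g
  refine shortExact_of_exists_desc _ ((MorphismProperty.monomorphisms A).of_isPushout hP.flip hi)
    (epi_of_epi_fac hg) (fun k hk => ?_)
  obtain ⟨l, hl⟩ := ShortExact.exists_desc h (g ≫ k) (by rw [hP.w_assoc, hk, comp_zero])
  exact ⟨l, hP.hom_ext (by rw [reassoc_of% hg, hl]) (by rw [reassoc_of% w', hk, zero_comp])⟩

/-- A pullback of a short exact sequence along a morphism into its cokernel is short exact. -/
lemma shortExact_of_isPullback {X Y Z Z' Y' : A} {i : X ⟶ Y} {p : Y ⟶ Z} {w : i ≫ p = 0}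
    (h : (ShortComplex.mk i p w).ShortExact) {f : Z' ⟶ Z} {g : Y' ⟶ Y} {p' : Y' ⟶ Z'} {i' : X ⟶ Y'}
    (hP : IsPullback g p' p f) (hg : i' ≫ g = i) (w' : i' ≫ p' = 0) :
    (ShortComplex.mk i' p' w').ShortExact := by
  have hi : Mono i := h.mono_f
  have hp : Epi p := h.epi_g
  refine shortExact_of_exists_lift _ (mono_of_mono_fac hg)
    ((MorphismProperty.epimorphisms A).of_isPullback hP hp) (fun k hk => ?_)
  obtain ⟨l, hl⟩ := ShortExact.exists_lift h (k ≫ g)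
    (by rw [Category.assoc, hP.w, reassoc_of% hk, zero_comp])
  exact ⟨l, hP.hom_ext (by rw [Category.assoc, hg, hl]) (by rw [Category.assoc, w', hk, comp_zero])⟩

variable {B : Type*} [Category* B] [Preadditive B] (Φ : B ⥤ A) [Φ.Additive]

/-- The sequences which become short exact in `A`. -/
def shortExactClass : ObjectProperty (ShortComplex B) := fun S => (S.map Φ).ShortExact

lemma shortExactClass_mk {X Y Z : B} {i : X ⟶ Y} {p : Y ⟶ Z} {w : i ≫ p = 0} :
    shortExactClass Φ (ShortComplex.mk i p w) ↔ (ShortComplex.mk (Φ.map i) (Φ.map p)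
      (by rw [← Φ.map_comp, w, Φ.map_zero])).ShortExact := Iff.rfl

variable [Φ.Full] [Φ.Faithful]

/-- A fully faithful additive subcategory of an abelian category which contains zero and is closed
under extensions is an exact category. -/
theorem isExactCategory_shortExactClass (h₀ : ∃ o : B, IsZero o)
    (hext : ∀ (X Z : B) (M : A) (f : Φ.obj X ⟶ M) (g : M ⟶ Φ.obj Z) (w : f ≫ g = 0),
      (ShortComplex.mk f g w).ShortExact → ∃ Y, Nonempty (Φ.obj Y ≅ M)) :
    IsExactCategory (shortExactClass Φ) := by
  have hext' : ∀ {X Z : B} {M : A} {f : Φ.obj X ⟶ M} {g : M ⟶ Φ.obj Z} {w : f ≫ g = 0},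
      (ShortComplex.mk f g w).ShortExact → ∃ (Y : B) (e : Φ.obj Y ≅ M) (i : X ⟶ Y) (p : Y ⟶ Z)
        (w' : i ≫ p = 0), Φ.map i = f ≫ e.inv ∧ Φ.map p = e.hom ≫ g ∧
        shortExactClass Φ (ShortComplex.mk i p w') := by
    intro X Z M f g w h
    obtain ⟨Y, ⟨e⟩⟩ := hext X Z M f g w h
    have w' : Φ.preimage (f ≫ e.inv) ≫ Φ.preimage (e.hom ≫ g) = 0 :=
      Φ.map_injective (by simp [w])
    refine ⟨Y, e, Φ.preimage (f ≫ e.inv), Φ.preimage (e.hom ≫ g), w', by simp, by simp, ?_⟩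
    rw [shortExactClass_mk]
    exact shortExact_of_isos h _ (Iso.refl _) e.symm (Iso.refl _) (by simp) (by simp)
  obtain ⟨o, ho⟩ := h₀
  have : HasZeroObject B := ⟨o, ho⟩
  have hΦo : IsZero (Φ.obj o) := Φ.map_isZero ho
  exact
  { hasFiniteBiproducts := by
      have : HasBinaryBiproducts B := ⟨fun X Y => by
        obtain ⟨Z, e, -⟩ := hext' (ShortComplex.Splitting.ofHasBinaryBiproduct
          (Φ.obj X) (Φ.obj Y)).shortExact
        exact hasBinaryBiproduct_of_total
          { pt := Z
            fst := Φ.preimage (e.hom ≫ biprod.fst)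
            snd := Φ.preimage (e.hom ≫ biprod.snd)
            inl := Φ.preimage (biprod.inl ≫ e.inv)
            inr := Φ.preimage (biprod.inr ≫ e.inv)
            inl_fst := Φ.map_injective (by simp)
            inl_snd := Φ.map_injective (by simp)
            inr_fst := Φ.map_injective (by simp)
            inr_snd := Φ.map_injective (by simp) }
          (Φ.map_injective (by
            rw [← cancel_epi e.inv, ← cancel_mono e.hom]
            simp [← biprod.total]))⟩
      have : HasFiniteProducts B := hasFiniteProducts_of_has_binary_and_terminal
      exact HasFiniteBiproducts.of_hasFiniteProducts
    isKernelCokernelPair := fun S hS => isKernelCokernelPair_of_map Φ hS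
    of_iso := fun S T ⟨e⟩ hS => ShortComplex.shortExact_of_iso (Φ.mapShortComplex.mapIso e) hS
    id_mono := fun X => ⟨o, 0, by simp, shortExact_of_exists_lift _ inferInstance
      ⟨fun _ _ _ => hΦo.eq_of_src _ _⟩ (fun k _ => ⟨k, by simp⟩)⟩
    id_epi := fun X => ⟨o, 0, by simp, shortExact_of_exists_desc _
      ⟨fun _ _ _ => hΦo.eq_of_tgt _ _⟩ inferInstance (fun k _ => ⟨k, by simp⟩)⟩
    comp_mono := by
      rintro X Y Z i j ⟨U, p, w, hp⟩ ⟨V, q, w', hq⟩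
      rw [shortExactClass_mk] at hp hq
      have hi : Mono (Φ.map i) := hp.mono_f
      have hj : Mono (Φ.map j) := hq.mono_f
      have hpe : Epi (Φ.map p) := hp.epi_g
      -- The cokernel of `i ≫ j` is the pushout of `j` along the cokernel of `i`: an extension of
      -- the cokernel of `j` by that of `i`, so it lies in `B`. Composites of epics are treated
      -- dually.
      have hP := IsPushout.of_hasPushout (Φ.map j) (Φ.map p)
      have h := shortExact_of_isPushout hq hP (p' := hP.desc (Φ.map q) 0
        (by rw [← Φ.map_comp, w', Φ.map_zero, comp_zero])) (by simp) (by simp)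
      obtain ⟨W, e, -⟩ := hext' h
      have hij : Φ.map (i ≫ j) ≫ pushout.inl (Φ.map j) (Φ.map p) = 0 := by
        rw [Φ.map_comp, Category.assoc, hP.w, ← Φ.map_comp_assoc, w, Φ.map_zero, zero_comp]
      have hS : (ShortComplex.mk (Φ.map (i ≫ j)) (pushout.inl (Φ.map j) (Φ.map p))
          hij).ShortExact := by
        refine shortExact_of_exists_desc _ (by rw [Φ.map_comp]; infer_instance)
          ((MorphismProperty.epimorphisms A).of_isPushout hP hpe) (fun k hk => ?_)
        rw [Φ.map_comp, Category.assoc] at hk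
        obtain ⟨l, hl⟩ := ShortExact.exists_desc hp _ hk
        exact ⟨hP.desc k l hl.symm, by simp⟩
      refine ⟨W, Φ.preimage (pushout.inl (Φ.map j) (Φ.map p) ≫ e.inv),
        Φ.map_injective (by rw [Φ.map_comp, Φ.map_preimage, reassoc_of% hij]; simp), ?_⟩
      rw [shortExactClass_mk]
      exact shortExact_of_isos hS _ (Iso.refl _) (Iso.refl _) e.symm (by simp) (by simp)
    comp_epi := by
      rintro X Y Z p q ⟨U, i, w, hp⟩ ⟨V, j, w', hq⟩
      rw [shortExactClass_mk] at hp hq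
      have hi : Epi (Φ.map p) := hp.epi_g
      have hj : Epi (Φ.map q) := hq.epi_g
      have hjm : Mono (Φ.map j) := hq.mono_f
      have hP := IsPullback.of_hasPullback (Φ.map p) (Φ.map j)
      have h := shortExact_of_isPullback hp hP (i' := hP.lift (Φ.map i) 0
        (by rw [← Φ.map_comp, w, Φ.map_zero, zero_comp])) (by simp) (by simp)
      obtain ⟨W, e, -⟩ := hext' h
      have hpq : pullback.fst (Φ.map p) (Φ.map j) ≫ Φ.map (p ≫ q) = 0 := by
        rw [Φ.map_comp, hP.w_assoc, ← Φ.map_comp, w', Φ.map_zero, comp_zero]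
      have hS : (ShortComplex.mk (pullback.fst (Φ.map p) (Φ.map j)) (Φ.map (p ≫ q))
          hpq).ShortExact := by
        refine shortExact_of_exists_lift _
          ((MorphismProperty.monomorphisms A).of_isPullback hP.flip hjm)
          (by rw [Φ.map_comp]; infer_instance) (fun k hk => ?_)
        rw [Φ.map_comp, ← Category.assoc] at hk
        obtain ⟨l, hl⟩ := ShortExact.exists_lift hq _ hk
        exact ⟨hP.lift k l hl.symm, by simp⟩
      refine ⟨W, Φ.preimage (e.hom ≫ pullback.fst (Φ.map p) (Φ.map j)),
        Φ.map_injective (by rw [Φ.map_comp, Φ.map_preimage, Category.assoc, hpq]; simp), ?_⟩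
      rw [shortExactClass_mk]
      exact shortExact_of_isos hS _ e.symm (Iso.refl _) (Iso.refl _) (by simp) (by simp)
    pushout_mono := by
      rintro X Y X' i f ⟨Z, p, w, h⟩
      rw [shortExactClass_mk] at h
      have hP := IsPushout.of_hasPushout (Φ.map i) (Φ.map f)
      have h' := shortExact_of_isPushout h hP (p' := hP.desc (Φ.map p) 0
        (by rw [← Φ.map_comp, w, Φ.map_zero, comp_zero])) (by simp) (by simp)
      obtain ⟨Y', e, i', p', w', hi', hp', h''⟩ := hext' h'
      refine ⟨Y', Φ.preimage (pushout.inl (Φ.map i) (Φ.map f) ≫ e.inv), i', ?_, _, p', w', h''⟩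
      refine IsPushout.of_map_of_faithful Φ ?_
      rw [Φ.map_preimage, hi']
      exact hP.of_iso (Iso.refl _) (Iso.refl _) (Iso.refl _) e.symm (by simp) (by simp) (by simp)
        (by simp)
    pullback_epi := by
      rintro Y Z Z' p f ⟨X, i, w, h⟩
      rw [shortExactClass_mk] at h
      have hP := IsPullback.of_hasPullback (Φ.map p) (Φ.map f)
      have h' := shortExact_of_isPullback h hP (i' := hP.lift (Φ.map i) 0
        (by rw [← Φ.map_comp, w, Φ.map_zero, zero_comp])) (by simp) (by simp)
      obtain ⟨Y', e, i', p', w', hi', hp', h''⟩ := hext' h'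
      refine ⟨Y', Φ.preimage (e.hom ≫ pullback.fst (Φ.map p) (Φ.map f)), p', ?_, _, i', w', h''⟩
      refine IsPullback.of_map_of_faithful Φ ?_
      rw [Φ.map_preimage, hp']
      exact hP.of_iso e.symm (Iso.refl _) (Iso.refl _) (Iso.refl _) (by simp) (by simp) (by simp)
        (by simp) }

end ExtensionClosed
end ExactCat

namespace ExactCat

/-! ### Extensions of Ind-objects are Ind-objects -/

section Extensions

open Opposite

variable {C : Type u} [Category.{v} C] [Preadditive C] {E : ObjectProperty (ShortComplex C)}

variable (E) in
/-- A section `m` of `F` over an extension `M` of `B` by `A`, which restricts to the section `a` of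
the subpresheaf, induces the section `b` of the quotient, and through which the section `y`
factors. -/
structure ExtensionSection {X F Z : Cᵒᵖ ⥤ AddCommGrpCat.{v}} (f : X ⟶ F) (g : F ⟶ Z) {A B P : C}
    (a : X.obj (op A)) (b : Z.obj (op B)) (q : P ⟶ B) (y : F.obj (op P)) where
  M : C
  m : F.obj (op M)
  s : A ⟶ M
  p : M ⟶ B
  r : P ⟶ M
  w : s ≫ p = 0
  exact : E (ShortComplex.mk s p w)
  res_s : res F s m = f.app _ a
  app_m : g.app _ m = res Z p b
  r_p : r ≫ p = q
  res_r : res F r m = y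

variable {X F Z : Cᵒᵖ ⥤ AddCommGrpCat.{v}} {f : X ⟶ F} {g : F ⟶ Z}

/-- `M` is the pushout of `k` along `l`, so `P ⊞ A ⟶ M` is an admissible epic with kernel `K`. The
section of `F` given by `y` on `P` and `a` on `A` vanishes on `K`, hence descends to `M`. -/
lemma exists_extensionSection (hE : IsExactCategory E) (hF : IsLeftExact E F)
    (hZ : IsLeftExact E Z) (h : IsLocallyExact E f g) {A B P K : C}
    (a : X.obj (op A)) (b : Z.obj (op B)) {q : P ⟶ B} {y : F.obj (op P)}
    (hy : g.app _ y = res Z q b) {k : K ⟶ P} {w : k ≫ q = 0} (hq : E (ShortComplex.mk k q w))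
    (l : K ⟶ A) (hl : f.app _ (res X l a) = res F k y) :
    Nonempty (ExtensionSection E f g a b q y) := by
  have := hF.additive hE
  have := hZ.additive hE
  have := hE.hasBinaryBiproducts
  obtain ⟨M, r, s, hP, -⟩ := hE.pushout_mono k l ⟨_, _, _, hq⟩
  have hp : k ≫ q = l ≫ 0 := by simp [w]
  have hR := hE.exact_biprod_of_isPushout ⟨_, _, _, hq⟩ hP
  obtain ⟨m, hm⟩ := hF.exists_of_res hR (res F biprod.fst y + res F biprod.snd (f.app _ a)) (by
    rw [map_add, ← res_comp, ← res_comp, biprod.lift_fst, biprod.lift_snd, res_neg, ← app_res, hl,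
      add_neg_cancel])
  refine ⟨⟨M, m, s, hP.desc q 0 hp, r, by simp,
    hE.exact_of_isPushout hq hP (by simp) (by simp), ?_, ?_, by simp, ?_⟩⟩
  · rw [← biprod.inr_desc r s, res_comp, hm, map_add, ← res_comp, ← res_comp]
    simp
  · refine hZ.eq_of_admissibleEpi ⟨_, _, _, hR⟩ _ _ ?_
    have : biprod.desc r s ≫ hP.desc q 0 hp = biprod.fst ≫ q := by ext <;> simp
    rw [← app_res, hm, map_add, app_res, app_res, h.zero, map_zero, add_zero, hy, ← res_comp,
      ← res_comp, this]
  · rw [← biprod.inl_desc r s, res_comp, hm, map_add, ← res_comp, ← res_comp]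
    simp

namespace ExtensionSection

variable {A B P : C} {a : X.obj (op A)} {b : Z.obj (op B)} {q : P ⟶ B} {y : F.obj (op P)}
  (π : ExtensionSection E f g a b q y)

include π in
lemma eq_zero_of_res (hE : IsExactCategory E) (h : IsLocallyExact E f g)
    (ha : ∀ {Y : C} (u : Y ⟶ A), res X u a = 0 → u = 0)
    (hb : ∀ {Y : C} (u : Y ⟶ B), res Z u b = 0 → u = 0) {Y : C} (u : Y ⟶ π.M)
    (hu : res F u π.m = 0) : u = 0 := by
  obtain ⟨l, rfl⟩ := hE.exists_lift π.exact u
    (hb _ (by rw [res_comp, ← π.app_m, ← app_res, hu, map_zero]))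
  rw [res_comp, π.res_s, ← app_res] at hu
  rw [ha l (h.eq_zero _ hu), zero_comp]

/-- Locally `z` is the sum of a multiple of `y` and one of `a`, so it factors through `M` locally.
It does so globally, because `M` is a subpresheaf of `F` that is itself left exact. -/
lemma exists_res_eq (hE : IsExactCategory E) (h : IsLocallyExact E f g) (hF : IsLeftExact E F)
    (ha : ∀ {Y : C} (u : Y ⟶ A), res X u a = 0 → u = 0)
    (hb : ∀ {Y : C} (u : Y ⟶ B), res Z u b = 0 → u = 0) {Y Q : C} (z : F.obj (op Y))
    {t : Q ⟶ Y} (ht : AdmissibleEpi E t) (l : Q ⟶ P) (c : Q ⟶ A)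
    (hc : f.app _ (res X c a) = res F t z - res F l y) : ∃ u : Y ⟶ π.M, res F u π.m = z := by
  have := hF.additive hE
  refine (isLeftExact_yoneda hE π.M).exists_of_locally hF (homOfSection F π.m) hE
    (fun {T} x hx => π.eq_zero_of_res hE h ha hb (show T ⟶ π.M from x) hx) z ht
    (l ≫ π.r + c ≫ π.s : Q ⟶ π.M) ?_
  rw [homOfSection_app, res_add, res_comp, res_comp, π.res_r, π.res_s, ← app_res, hc,
    add_sub_cancel]

end ExtensionSection

/-- The pairs of indices related by `P`. -/
@[ext]
structure RelatedPair {I J : Type*} (P : I → J → Prop) where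
  fst : I
  snd : J
  related : P fst snd

/-- An extension of an admissible Ind-object by another one is an admissible Ind-object. -/
theorem exists_diagram_of_isLocallyExact (hE : IsExactCategory E) (hF : IsLeftExact E F)
    (hX : IsLeftExact E X) (hZ : IsLeftExact E Z) (h : IsLocallyExact E f g) {I J : Type v}
    [PartialOrder I] [IsDirectedOrder I] [Nonempty I] [PartialOrder J] [IsDirectedOrder J]
    [Nonempty J] {A : I → C} {a : ∀ i, X.obj (op (A i))} (ha : IndPresentation E X A a)
    {B : J → C} {b : ∀ j, Z.obj (op (B j))} (hb : IndPresentation E Z B b) :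
    ∃ D : AdmissibleIndDiagram E, Cardinal.mk D.I ≤ Cardinal.mk I * Cardinal.mk J ∧
      Nonempty (F ≅ D.presheaf) := by
  have := hF.additive hE
  have := hX.additive hE
  have := hZ.additive hE
  choose P q y hq hy using fun j => h.exists_lift (b j)
  let Piece (i : I) (j : J) := ExtensionSection E f g (a i) (b j) (q j) (y j)
  have piece_inj {i : I} {j : J} (π : Piece i j) {Y : C} {u u' : Y ⟶ π.M}
      (hu : res F u π.m = res F u' π.m) : u = u' :=
    sub_eq_zero.1 (π.eq_zero_of_res hE h ha.eq_zero hb.eq_zero _ (by rw [res_sub, hu, sub_self]))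
  -- How large `i` must be depends on `j`: the restriction of `y j` to the kernel of `q j` has to
  -- factor through `A i`.
  have exists_piece (i₀ : I) (j : J) : ∃ i₁, i₀ ≤ i₁ ∧ ∀ i, i₁ ≤ i → Nonempty (Piece i j) := by
    obtain ⟨K, k, w, hk⟩ := hq j
    obtain ⟨x, hx⟩ := h.exact (res F k (y j)) (by rw [app_res, hy, ← res_comp, w, res_zero])
    obtain ⟨i₁, hi₁, l, hl⟩ := ha.exists_ge x i₀
    refine ⟨i₁, hi₁, fun i hi => ?_⟩
    obtain ⟨l', hl'⟩ := ha.exists_of_le hl hi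
    exact exists_extensionSection hE hF hZ h (a i) (b j) (hy j) hk l' (by rw [hl', hx])
  have exists_res (i₀ : I) {j : J} {Y : C} (z : F.obj (op Y)) (w : Y ⟶ B j)
      (hw : g.app _ z = res Z w (b j)) :
      ∃ i₁, i₀ ≤ i₁ ∧ ∀ i, i₁ ≤ i → ∀ π : Piece i j, ∃ u : Y ⟶ π.M, res F u π.m = z := by
    obtain ⟨Q, t, l, ht, htl⟩ := hE.exists_refinement (hq j) w
    obtain ⟨x, hx⟩ := h.exact (res F t z - res F l (y j)) (by
      rw [map_sub, app_res, app_res, hw, hy, ← res_comp, ← res_comp, htl, sub_self])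
    obtain ⟨i₁, hi₁, c, hc⟩ := ha.exists_ge x i₀
    refine ⟨i₁, hi₁, fun i hi π => ?_⟩
    obtain ⟨c', hc'⟩ := ha.exists_of_le hc hi
    exact π.exists_res_eq hE h hF ha.eq_zero hb.eq_zero z ht l c' (by rw [hc', hx])
  let T := RelatedPair (fun i j => Nonempty (Piece i j))
  let piece (t : T) : Piece t.fst t.snd := t.related.some
  let _ : PartialOrder T :=
    -- The product order alone does not suffice: the lifts chosen for two values of `j` may differ
    -- by a section of `X` that does not come from the larger `A i`.
    { le := fun t t' => (t.fst ≤ t'.fst ∧ t.snd ≤ t'.snd) ∧ ∃ u : (piece t).M ⟶ (piece t').M,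
        res F u (piece t').m = (piece t).m
      le_refl := fun t => ⟨⟨le_rfl, le_rfl⟩, 𝟙 _, res_id _ _⟩
      le_trans := fun t t' t'' ⟨h₁, u, hu⟩ ⟨h₂, u', hu'⟩ =>
        ⟨⟨h₁.1.trans h₂.1, h₁.2.trans h₂.2⟩, u ≫ u', by rw [res_comp, hu', hu]⟩
      le_antisymm := fun t t' h₁ h₂ => RelatedPair.ext (le_antisymm h₁.1.1 h₂.1.1)
        (le_antisymm h₁.1.2 h₂.1.2) }
  have : Nonempty T := by
    obtain ⟨i₀⟩ := ‹Nonempty I›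
    obtain ⟨j⟩ := ‹Nonempty J›
    obtain ⟨i, -, hi⟩ := exists_piece i₀ j
    exact ⟨⟨i, j, hi i le_rfl⟩⟩
  have : IsDirectedOrder T := ⟨fun t₁ t₂ => by
    -- First `j` is fixed; then `i` is enlarged until both pieces map to the piece at `(i, j)` and
    -- that piece exists.
    obtain ⟨j, hj₁, hj₂⟩ := exists_ge_ge t₁.snd t₂.snd
    obtain ⟨i₀, hi₁, hi₂⟩ := exists_ge_ge t₁.fst t₂.fst
    obtain ⟨β₁, -, hβ₁⟩ := hb.trans hj₁
    obtain ⟨β₂, -, hβ₂⟩ := hb.trans hj₂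
    obtain ⟨i₁, h₁, hi₁'⟩ := exists_res i₀ (j := j) (piece t₁).m ((piece t₁).p ≫ β₁)
      (by rw [(piece t₁).app_m, res_comp, hβ₁])
    obtain ⟨i₂, h₂, hi₂'⟩ := exists_res i₁ (j := j) (piece t₂).m ((piece t₂).p ≫ β₂)
      (by rw [(piece t₂).app_m, res_comp, hβ₂])
    obtain ⟨i, h₃, hi⟩ := exists_piece i₂ j
    exact ⟨⟨i, j, hi i le_rfl⟩,
      ⟨⟨hi₁.trans (h₁.trans (h₂.trans h₃)), hj₁⟩, hi₁' i (h₂.trans h₃) _⟩,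
      ⟨⟨hi₂.trans (h₁.trans (h₂.trans h₃)), hj₂⟩, hi₂' i h₃ _⟩⟩⟩
  have hT : IndPresentation E F (fun t : T => (piece t).M) (fun t => (piece t).m) :=
    { eq_zero := fun {t Y} u hu => (piece t).eq_zero_of_res hE h ha.eq_zero hb.eq_zero u hu
      trans := fun {t t'} htt' => by
        obtain ⟨⟨hi, hj⟩, u, hu⟩ := htt'
        obtain ⟨α, hα, hα'⟩ := ha.trans hi
        obtain ⟨β, hβ, hβ'⟩ := hb.trans hj
        refine ⟨u, hE.admissibleMono_of_exact (piece t).exact (piece t').exact hα hβ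
          (piece_inj _ ?_) (hb.eq_of_res ?_), hu⟩
        · rw [res_comp, res_comp, hu, (piece t).res_s, (piece t').res_s, ← app_res, hα']
        · rw [res_comp, res_comp, hβ', ← (piece t').app_m, ← app_res, hu, (piece t).app_m]
      cover := fun {Y} z => by
        obtain ⟨j, w, hw⟩ := hb.cover (g.app _ z)
        obtain ⟨i₀⟩ := ‹Nonempty I›
        obtain ⟨i₁, -, h₁⟩ := exists_res i₀ z w hw.symm
        obtain ⟨i₂, h₂, hi⟩ := exists_piece i₁ j
        exact ⟨⟨i₂, j, hi i₂ le_rfl⟩, h₁ i₂ h₂ _⟩ }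
  obtain ⟨D, hD, e⟩ := hT.exists_diagram
  refine ⟨D, ?_, e⟩
  rw [hD, Cardinal.mul_def]
  exact Cardinal.mk_le_of_injective (f := fun t : T => (t.fst, t.snd))
    fun t t' h => RelatedPair.ext (congrArg Prod.fst h) (congrArg Prod.snd h)

end Extensions
end ExactCat

namespace ExactCat

/-! ### Left specialness: resolutions by finite direct sums -/

section LeftSpecialness

open Opposite

/-- The finite subsets of `I` which have a greatest element. -/
@[ext]
structure ToppedFinset (I : Type*) [PartialOrder I] where
  set : Finset I
  top : I
  top_mem : top ∈ set
  le_top : ∀ j ∈ set, j ≤ top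

namespace ToppedFinset

variable {I : Type*} [PartialOrder I]

/-- The greatest element is determined by the set, so these index sets are no more numerous than the
finite subsets of `I`. -/
lemma set_injective : Function.Injective (set : ToppedFinset I → Finset I) := fun s t h =>
  ToppedFinset.ext h (le_antisymm (t.le_top _ (h ▸ s.top_mem)) (s.le_top _ (h ▸ t.top_mem)))

instance : PartialOrder (ToppedFinset I) := PartialOrder.lift set set_injective

/-- The singleton of `i`. -/
def single (i : I) : ToppedFinset I := ⟨{i}, i, by simp, by simp⟩

instance [Nonempty I] : Nonempty (ToppedFinset I) := ⟨single (Classical.arbitrary I)⟩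

lemma top_le {s t : ToppedFinset I} (h : s ≤ t) : s.top ≤ t.top :=
  t.le_top _ (h s.top_mem)

instance [IsDirectedOrder I] : IsDirectedOrder (ToppedFinset I) := ⟨fun s t => by
  classical
  obtain ⟨i, hs, ht⟩ := exists_ge_ge s.top t.top
  refine ⟨⟨insert i (s.set ∪ t.set), i, by simp, fun j hj => ?_⟩, fun j hj => ?_, fun j hj => ?_⟩
  · rw [Finset.mem_insert, Finset.mem_union] at hj
    rcases hj with rfl | hj | hj
    · exact le_rfl
    · exact (s.le_top j hj).trans hs
    · exact (t.le_top j hj).trans ht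
  · exact Finset.mem_insert_of_mem (Finset.mem_union_left _ hj)
  · exact Finset.mem_insert_of_mem (Finset.mem_union_right _ hj)⟩

end ToppedFinset

variable {C : Type u} [Category.{v} C] [Preadditive C] {E : ObjectProperty (ShortComplex C)}

lemma ext_of_biproduct {F : Cᵒᵖ ⥤ AddCommGrpCat.{v}} [F.Additive] [HasFiniteBiproducts C]
    {ι : Type*} [Fintype ι] {P : ι → C} {x y : F.obj (op (⨁ P))}
    (h : ∀ j, res F (biproduct.ι P j) x = res F (biproduct.ι P j) y) : x = y := by
  have total : ∑ j, biproduct.π P j ≫ biproduct.ι P j = 𝟙 (⨁ P) :=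
    IsBilimit.total (biproduct.isBilimit P)
  rw [← sub_eq_zero, ← res_id F (x - y), ← total, res_sum]
  exact Finset.sum_eq_zero fun j _ => by rw [res_comp, map_sub, h, sub_self, map_zero]

lemma exists_of_biproduct {F : Cᵒᵖ ⥤ AddCommGrpCat.{v}} [F.Additive] [HasFiniteBiproducts C]
    {ι : Type*} [Fintype ι] {P : ι → C} (y : ∀ j, F.obj (op (P j))) :
    ∃ x : F.obj (op (⨁ P)), ∀ j, res F (biproduct.ι P j) x = y j := by
  classical
  refine ⟨∑ k, res F (biproduct.π P k) (y k), fun j => ?_⟩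
  rw [map_sum, Finset.sum_eq_single j]
  · rw [← res_comp, biproduct.ι_π_self, res_id]
  · intro k _ hk
    rw [← res_comp, biproduct.ι_π_ne _ hk.symm, res_zero]
  · simp

/-- The direct sums of the finite subfamilies, with greatest index, of a family of objects. -/
structure FiniteSums {I : Type*} [PartialOrder I] (P : I → C) where
  obj : ToppedFinset I ⥤ C
  ι : ∀ (s : ToppedFinset I) (j : I), j ∈ s.set → (P j ⟶ obj.obj s)
  ι_map : ∀ {s t : ToppedFinset I} (h : s ⟶ t) (j : I) (hj : j ∈ s.set),
    ι s j hj ≫ obj.map h = ι t j (h.le hj)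
  hom_ext : ∀ {s : ToppedFinset I} {W : C} {g g' : obj.obj s ⟶ W},
    (∀ j hj, ι s j hj ≫ g = ι s j hj ≫ g') → g = g'
  exists_hom : ∀ {s : ToppedFinset I} {W : C} (f : ∀ j ∈ s.set, P j ⟶ W),
    ∃ g : obj.obj s ⟶ W, ∀ j hj, ι s j hj ≫ g = f j hj
  res_ext : ∀ {F : Cᵒᵖ ⥤ AddCommGrpCat.{v}} [F.Additive] {s : ToppedFinset I}
    {x y : F.obj (op (obj.obj s))}, (∀ j hj, res F (ι s j hj) x = res F (ι s j hj) y) → x = y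
  exists_res : ∀ {F : Cᵒᵖ ⥤ AddCommGrpCat.{v}} [F.Additive] {s : ToppedFinset I}
    (y : ∀ j ∈ s.set, F.obj (op (P j))), ∃ x : F.obj (op (obj.obj s)),
    ∀ j hj, res F (ι s j hj) x = y j hj

lemma nonempty_finiteSums [HasFiniteBiproducts C] {I : Type*} [PartialOrder I] (P : I → C) :
    Nonempty (FiniteSums P) :=
  ⟨{ obj :=
      { obj := fun s => ⨁ fun j : s.set => P j
        map := fun {s t} h =>
          biproduct.desc fun j => biproduct.ι (fun j : t.set => P j) ⟨j, h.le j.2⟩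
        map_id := fun s => biproduct.hom_ext' _ _ fun j => by simp
        map_comp := fun f g => biproduct.hom_ext' _ _ fun j => by simp }
     ι := fun s j hj => biproduct.ι (fun j : s.set => P j) ⟨j, hj⟩
     ι_map := fun h j hj => by simp
     hom_ext := fun h => biproduct.hom_ext' _ _ fun j => h j.1 j.2
     exists_hom := fun f => ⟨biproduct.desc fun j => f j.1 j.2, fun j hj => by simp⟩
     res_ext := fun h => ext_of_biproduct fun j => h j.1 j.2
     exists_res := fun {F _ s} y => by
      obtain ⟨x, hx⟩ := exists_of_biproduct (F := F) fun j : s.set => y j.1 j.2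
      exact ⟨x, fun j hj => hx ⟨j, hj⟩⟩ }⟩

lemma FiniteSums.exists_retraction {I : Type*} [PartialOrder I] {P : I → C} (S : FiniteSums P)
    {s t : ToppedFinset I} (h : s ⟶ t) : ∃ r, S.obj.map h ≫ r = 𝟙 _ := by
  classical
  obtain ⟨r, hr⟩ := S.exists_hom (s := t)
    (fun j _ => if hj : j ∈ s.set then S.ι s j hj else 0)
  exact ⟨r, S.hom_ext fun j hj => by simp [reassoc_of% S.ι_map, hr, hj]⟩

/-- A quotient which is an admissible Ind-object is locally covered by an admissible Ind-object
whose kernel is one as well. -/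
theorem exists_resolution (hE : IsExactCategory E) (hC : WeaklyIdempotentComplete C)
    {G F X : Cᵒᵖ ⥤ AddCommGrpCat.{v}} (hF : IsLeftExact E F) (hX : IsLeftExact E X)
    {f : G ⟶ F} {g : F ⟶ X} (h : IsLocallyExact E f g)
    (D : AdmissibleIndDiagram E) (e : D.presheaf ≅ X) :
    ∃ (K D' : AdmissibleIndDiagram E) (i : K.presheaf ⟶ D'.presheaf) (p : D'.presheaf ⟶ X)
      (a : K.presheaf ⟶ G) (b : D'.presheaf ⟶ F),
      Cardinal.mk K.I ≤ Cardinal.mk (Finset D.I) ∧ Cardinal.mk D'.I ≤ Cardinal.mk (Finset D.I) ∧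
      IsLocallyExact E i p ∧ i ≫ b = a ≫ f ∧ b ≫ g = p := by
  have := hE.hasFiniteBiproducts
  have := hF.additive hE
  have := hX.additive hE
  let x (i : D.I) : X.obj (op (D.X.obj i)) := e.hom.app _ (D.gen i)
  have hx : IndPresentation E X D.X.obj x := (D.presentation hE).of_iso e
  have res_x {i j : D.I} (f : i ⟶ j) : res X (D.X.map f) (x j) = x i := by
    rw [← app_res, D.res_gen]
  choose P p y hp hy using fun i => h.exists_lift (x i)
  let T := ToppedFinset D.I
  obtain ⟨S⟩ := nonempty_finiteSums P
  -- The greatest index of `s` supplies a common target for the maps out of the summands.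
  choose π ι_π using fun s : T => S.exists_hom (s := s)
    fun j hj => p j ≫ D.X.map (homOfLE (s.le_top j hj))
  have S_π {s t : T} (h : s ⟶ t) :
      S.obj.map h ≫ π t = π s ≫ D.X.map (homOfLE (ToppedFinset.top_le h.le)) :=
    S.hom_ext fun j hj => by
      rw [reassoc_of% S.ι_map, ι_π, reassoc_of% ι_π, ← D.X.map_comp]
      rfl
  have S_mono {s t : T} (h : s ⟶ t) : AdmissibleMono E (S.obj.map h) := by
    obtain ⟨r, hr⟩ := S.exists_retraction h
    exact hE.admissibleMono_of_comp hC _ r (by rw [hr]; exact hE.id_mono _)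
  have π_epi (s : T) : AdmissibleEpi E (π s) := by
    -- Restricted to the summand of the greatest index, `π s` is the admissible epic `p s.top`.
    refine hE.admissibleEpi_of_comp hC (S.ι s s.top s.top_mem) _ ?_
    have : homOfLE (s.le_top s.top s.top_mem) = 𝟙 s.top := rfl
    rw [ι_π, this, D.X.map_id, Category.comp_id]
    exact hp _
  choose N k w hk using π_epi
  have k_mono (s : T) : Mono (k s) := hE.mono_of_exact (hk s)
  have exists_n {s t : T} (h : s ⟶ t) : ∃ n : N s ⟶ N t, n ≫ k t = k s ≫ S.obj.map h :=
    hE.exists_lift (hk t) _ (by rw [Category.assoc, S_π, reassoc_of% w, zero_comp])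
  choose n hn using @exists_n
  let D' : AdmissibleIndDiagram E :=
    { I := T
      directed := inferInstance
      nonempty := inferInstance
      X := S.obj
      admissible := S_mono }
  let K : AdmissibleIndDiagram E :=
    { I := T
      directed := inferInstance
      nonempty := inferInstance
      X :=
        { obj := N
          map := n
          map_id := fun s => by rw [← cancel_mono (k s), hn]; simp
          map_comp := fun f g => by
            rw [← cancel_mono (k _), hn, Category.assoc, hn, reassoc_of% hn, S.obj.map_comp] }
      -- Followed by `k t`, the map on kernels is a composite of admissible monics; weak idempotent
      -- completeness allows `k t` to be cancelled.
      admissible := fun {s t} h => hE.admissibleMono_of_comp hC _ (k t) (by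
        rw [hn]
        exact hE.comp_mono _ _ ⟨_, _, _, hk s⟩ (S_mono h)) }
  have hD' := D'.presentation hE
  have hK := K.presentation hE
  obtain ⟨φ, hφ⟩ := D'.exists_hom (fun s => res X (π s) (x s.top)) (fun {s t} h => by
    rw [← res_comp, S_π, res_comp, res_x])
  obtain ⟨i, hi⟩ := K.exists_hom (fun s => res D'.presheaf (k s) (D'.gen s)) (fun {s t} h => by
    rw [← res_comp, hn, res_comp, D'.res_gen])
  -- The chosen lifts `y j` assemble to a section of `F` over each sum, which defines `b`.
  choose z hz using fun s : T => S.exists_res (F := F) (s := s) fun j _ => y j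
  obtain ⟨b, hb⟩ := D'.exists_hom z (fun {s t} h => S.res_ext fun j hj => by
    rw [← res_comp, S.ι_map, hz, hz])
  have hbφ : b ≫ g = φ := D'.hom_ext fun s => by
    change g.app _ (b.app _ (D'.gen s)) = _
    rw [hb, hφ]
    refine S.res_ext fun j hj => ?_
    rw [← app_res, hz, hy, ← res_comp, ι_π, res_comp, res_x]
  have hex : IsLocallyExact E i φ :=
    { eq_zero := fun {Y} c hc => by
        obtain ⟨s, u, rfl⟩ := K.exists_res_gen c
        rw [app_res, hi, ← res_comp] at hc
        have := hD'.eq_zero _ hc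
        rw [(Preadditive.mono_iff_cancel_zero (k s)).1 (k_mono s) _ _ this, res_zero]
      zero := fun {Y} c => by
        obtain ⟨s, u, rfl⟩ := K.exists_res_gen c
        rw [app_res, app_res, hi, app_res, hφ, ← res_comp (f := k s), w, res_zero, map_zero]
      exact := fun {Y} c hc => by
        obtain ⟨s, u, rfl⟩ := D'.exists_res_gen c
        rw [app_res, hφ, ← res_comp] at hc
        obtain ⟨l, rfl⟩ := hE.exists_lift (hk s) u (hx.eq_zero _ hc)
        exact ⟨res K.presheaf l (K.gen s), by rw [app_res, hi, res_comp]⟩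
      exists_lift := fun {Y} c => by
        obtain ⟨i, u, rfl⟩ := hx.cover c
        obtain ⟨Q, t, l, ht, htl⟩ := hE.exists_refinement (hp i) u
        -- The summand `P i` alone already covers `D.X.obj i`.
        let s : T := ToppedFinset.single i
        have his : i ∈ s.set := s.top_mem
        refine ⟨Q, t, res D'.presheaf (l ≫ S.ι s i his) (D'.gen s), ht, ?_⟩
        rw [app_res, hφ, res_comp, ← res_comp (g := π s), ι_π, res_comp, res_x, ← res_comp, htl,
          res_comp] }
  obtain ⟨a, ha⟩ := h.exists_hom (i ≫ b) (by
    rw [Category.assoc, hbφ]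
    exact K.hom_ext fun s => hex.zero _)
  have hT : Cardinal.mk T ≤ Cardinal.mk (Finset D.I) :=
    Cardinal.mk_le_of_injective ToppedFinset.set_injective
  exact ⟨K, D', i, φ, a, b, hT, hT, hex, ha.symm, hbφ⟩

end LeftSpecialness
end ExactCat

namespace ExactCat

/-! ### All cardinality bounds at once -/

section IndObjectsOfSize

open Opposite

variable {C : Type u} [Category.{v} C] [Preadditive C] {E : ObjectProperty (ShortComplex C)}

variable (E) in
/-- Admissible Ind-objects whose index poset has a cardinality satisfying `Q`. -/
def indWithCardinal (Q : Cardinal.{v} → Prop) : ObjectProperty (Lex E) :=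
  fun F => ∃ D : AdmissibleIndDiagram E, Q (Cardinal.mk D.I) ∧ Nonempty (F.obj ≅ D.presheaf)

/-- The constant admissible Ind-diagram with one index. -/
def AdmissibleIndDiagram.const (hE : IsExactCategory E) (X : C) : AdmissibleIndDiagram E where
  I := PUnit
  X := (Functor.const _).obj X
  admissible _ := hE.id_mono X

/-- The admissible Ind-object of an admissible Ind-diagram. -/
noncomputable def AdmissibleIndDiagram.lex (hE : IsExactCategory E) (D : AdmissibleIndDiagram E) :
    Lex E :=
  ⟨D.presheaf, (D.presentation hE).isLeftExact hE⟩

variable {Q : Cardinal.{v} → Prop}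

lemma AdmissibleIndDiagram.indWithCardinal_lex (hE : IsExactCategory E) (D : AdmissibleIndDiagram E)
    (hD : Q (Cardinal.mk D.I)) : indWithCardinal E Q (D.lex hE) :=
  ⟨D, hD, ⟨Iso.refl _⟩⟩

lemma isZero_indWithCardinal (hE : IsExactCategory E) (h₁ : Q 1) :
    ∃ o : (indWithCardinal E Q).FullSubcategory, IsZero o := by
  have := hE.hasFiniteBiproducts
  obtain ⟨o, ho⟩ := hasZeroObject_of_hasFiniteBiproducts C
  let D := AdmissibleIndDiagram.const hE o
  refine ⟨⟨D.lex hE, D.indWithCardinal_lex hE (by simpa [D, AdmissibleIndDiagram.const] using h₁)⟩,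
    (IsZero.iff_id_eq_zero _).2 (ObjectProperty.hom_ext _ (ObjectProperty.hom_ext _ ?_))⟩
  ext Y x
  obtain ⟨i, u, rfl⟩ := D.exists_res_gen (Y := unop Y) x
  have hu : u = 0 := ho.eq_of_tgt _ _
  rw [hu, res_zero]
  exact (map_zero ((𝟙 D.presheaf : D.presheaf ⟶ D.presheaf).app Y).hom)

theorem closedUnderExtensions_indWithCardinal (hE : IsExactCategory E)
    (hQ : ∀ a b, a ≤ b → Q b → Q a) (hmul : ∀ a b, Q a → Q b → Q (a * b)) :
    ClosedUnderExtensions (lexExact E) (indWithCardinal E Q) := by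
  rintro S hS ⟨D, hD, ⟨e⟩⟩ ⟨D', hD', ⟨e'⟩⟩
  obtain ⟨D'', h, he⟩ := exists_diagram_of_isLocallyExact hE S.X₂.property S.X₁.property
    S.X₃.property (isLocallyExact_of_lexExact hE hS) ((D.presentation hE).of_iso e.symm)
    ((D'.presentation hE).of_iso e'.symm)
  exact ⟨D'', hQ _ _ h (hmul _ _ hD hD'), he⟩

variable [EssentiallySmall.{v} C]

/-- The inherited class consists of the sequences that are short exact as sheaves. An extension of
Ind-objects among sheaves is left exact, so closure under extensions in `Lex E` carries over to
sheaves. -/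
theorem isExactCategory_indWithCardinal (hE : IsExactCategory E) (h₁ : Q 1)
    (hQ : ∀ a b, a ≤ b → Q b → Q a) (hmul : ∀ a b, Q a → Q b → Q (a * b)) :
    IsExactCategory (inheritedClass (lexExact E) (indWithCardinal E Q)) := by
  have h : inheritedClass (lexExact E) (indWithCardinal E Q) =
      shortExactClass ((indWithCardinal E Q).ι ⋙ lexToSheaf hE) :=
    funext fun S => propext (lexExact_iff hE)
  rw [h]
  refine isExactCategory_shortExactClass _ (isZero_indWithCardinal hE h₁) fun X Z M f g w hS => ?_
  have hM : IsLeftExact E M.obj := isLeftExact_of_shortExact hE hS X.obj.property Z.obj.property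
  let Y : Lex E := ⟨M.obj, hM⟩
  let S : ShortComplex (Lex E) := ShortComplex.mk (X₁ := X.obj) (X₂ := Y) (X₃ := Z.obj)
    (ObjectProperty.homMk f.hom) (ObjectProperty.homMk g.hom)
    (ObjectProperty.hom_ext _
      ((congrArg InducedCategory.Hom.hom w : (f ≫ g).hom = 0)))
  have hS' : lexExact E S := (lexExact_iff hE).2 hS
  exact ⟨⟨Y, closedUnderExtensions_indWithCardinal hE hQ hmul S hS' X.property Z.property⟩,
    ⟨Iso.refl _⟩⟩

/-- `hfin` is needed because the resolution is indexed by finite sets of indices. -/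
theorem leftSpecial_indWithCardinal (hE : IsExactCategory E) (hC : WeaklyIdempotentComplete C)
    (hQ : ∀ a b, a ≤ b → Q b → Q a)
    (hfin : ∀ I : Type v, Q (Cardinal.mk I) → Q (Cardinal.mk (Finset I))) :
    LeftSpecial (lexExact E) (indWithCardinal E Q)
      (inheritedClass (lexExact E) (indWithCardinal E Q)) := by
  rintro X G F j q w hS
  obtain ⟨D, hD, ⟨e⟩⟩ := X.property
  obtain ⟨K, D', i, p, a, b, hK, hD', h, hab, hbp⟩ := exists_resolution hE hC F.property
    X.obj.property (isLocallyExact_of_lexExact hE hS) D e.symm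
  have w' : i ≫ p = 0 := by
    ext Y x
    exact h.zero (Y := unop Y) x
  exact ⟨⟨K.lex hE, K.indWithCardinal_lex hE (hQ _ _ hK (hfin _ hD))⟩,
    ⟨D'.lex hE, D'.indWithCardinal_lex hE (hQ _ _ hD' (hfin _ hD))⟩,
    ObjectProperty.homMk (ObjectProperty.homMk i), ObjectProperty.homMk (ObjectProperty.homMk p),
    ObjectProperty.hom_ext _ (ObjectProperty.hom_ext _ w'), ObjectProperty.homMk a,
    ObjectProperty.homMk b, (lexExact_iff_isLocallyExact hE).2 h, ObjectProperty.hom_ext _ hab,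
    ObjectProperty.hom_ext _ hbp⟩

end IndObjectsOfSize
end ExactCat


theorem theorem3p3 {C : Type u} [Category.{v} C] [Preadditive C] [EssentiallySmall.{v} C]
    (E : ObjectProperty (ShortComplex C)) (hE : ExactCat.IsExactCategory E) :
    (∀ κ : Cardinal.{v}, Cardinal.aleph0 ≤ κ →
      ExactCat.ClosedUnderExtensions (ExactCat.lexExact E) (ExactCat.IndAOfSize E κ) ∧
      ExactCat.IsExactCategory
        (ExactCat.inheritedClass (ExactCat.lexExact E) (ExactCat.IndAOfSize E κ)) ∧
      (ExactCat.WeaklyIdempotentComplete C →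
        ExactCat.LeftSpecial (ExactCat.lexExact E) (ExactCat.IndAOfSize E κ)
          (ExactCat.inheritedClass (ExactCat.lexExact E) (ExactCat.IndAOfSize E κ)))) ∧
    (ExactCat.ClosedUnderExtensions (ExactCat.lexExact E) (ExactCat.IndA E) ∧
      ExactCat.IsExactCategory
        (ExactCat.inheritedClass (ExactCat.lexExact E) (ExactCat.IndA E)) ∧
      (ExactCat.WeaklyIdempotentComplete C →
        ExactCat.LeftSpecial (ExactCat.lexExact E) (ExactCat.IndA E)
          (ExactCat.inheritedClass (ExactCat.lexExact E) (ExactCat.IndA E)))) := by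
  have main (Q : Cardinal.{v} → Prop) (h₁ : Q 1) (hQ : ∀ a b, a ≤ b → Q b → Q a)
      (hmul : ∀ a b, Q a → Q b → Q (a * b))
      (hfin : ∀ I : Type v, Q (Cardinal.mk I) → Q (Cardinal.mk (Finset I))) :=
    And.intro (ExactCat.closedUnderExtensions_indWithCardinal hE hQ hmul)
      (And.intro (ExactCat.isExactCategory_indWithCardinal hE h₁ hQ hmul)
        fun hC => ExactCat.leftSpecial_indWithCardinal hE hC hQ hfin)
  refine ⟨fun κ hκ => main (· ≤ κ) (Cardinal.one_le_aleph0.trans hκ) (fun a b h h' => h.trans h')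
    (fun a b ha hb => (mul_le_mul' ha hb).trans (Cardinal.mul_eq_self hκ).le) fun I hI => ?_, ?_⟩
  -- An infinite `I` has as many finite subsets as elements; a finite `I` has finitely many, and `κ`
  -- is infinite.
  · rcases finite_or_infinite I with h | h
    · exact (Cardinal.mk_lt_aleph0 (α := Finset I)).le.trans hκ
    · exact (Cardinal.mk_finset_of_infinite I).le.trans hI
  · have h : ExactCat.IndA E = ExactCat.indWithCardinal E fun _ => True := by
      ext F
      simp [ExactCat.IndA, ExactCat.indWithCardinal]
    rw [h]
    exact main _ trivial (fun _ _ _ _ => trivial) (fun _ _ _ _ => trivial) fun _ _ => trivial
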